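/- Let $n\ge 1$, let $K_w,K_v\in\mathbb{R}^{n\times n}$ be symmetric positive definite, and let $P\ge 0$. For a strictly lower triangular matrix $B\in\mathbb{R}^{n\times n}$ and a symmetric positive semidefinite matrix $K_s\in\mathbb{R}^{n\times n}$ let $S^n\sim N(0,K_s)$ (message vector), $W^n\sim N(0,K_w)$ (channel noise) and $V^n\sim N(0,K_v)$ (feedback noise) be independent random vectors, and let $$X^n=S^n+B(W^n+V^n),\qquad Y^n=X^n+W^n$$ be the input and the output of the Gaussian channel with additive Gaussian noise feedback under linear feedback coding. Let $K_x$ be the covariance matrix of $X^n$, so that $\operatorname{tr}K_x=\operatorname{tr}\bigl(K_s+B(K_w+K_v)B^T\bigr)$. Logarithms are to base $2$ and information is measured in bits. Write $$I(X^n\to Y^n\mid V^n)=\sum_{i=1}^n I(X^i;Y_i\mid Y^{i-1},V^n)$$ for the conditional directed information, where $X^i=(X_1,\dots,X_i)$ and $Y^{i-1}=(Y_1,\dots,Y_{i-1})$. Let $$R_{n,\max}(P)=\max_{B,K_s}\ \tfrac1n I(S^n;Y^n),\qquad C_n(P)=\max_{B,K_s}\ \tfrac1n I(X^n\to Y^n\mid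 V^n),$$ both maxima being over all strictly lower triangular $B$ and all $K_s\ge 0$ with $\operatorname{tr}K_x\le nP$; $R_{n,\max}(P)$ is the largest $n$-block achievable rate of the scheme. Consider also the program in $(H,B)\in\mathbb{R}^{n\times n}\times\mathbb{R}^{n\times n}$ $$\begin{aligned} \text{maximize}\quad & \frac1{2n}\log\det\begin{bmatrix}K_v^{-1}&B^T\\ B&H\end{bmatrix}-\frac1{2n}\log\det(K_v^{-1}K_w)\\ \text{subject to}\quad & \operatorname{tr}(H-K_wB^T-BK_w-K_w)\le nP,\\ & \begin{bmatrix}H& I+B& B\\ I+B^T&K_w^{-1}&0\\ B^T&0&K_v^{-1}\end{bmatrix}\ge 0,\\ & B\ \text{strictly lower triangular}, \end{aligned}$$ where $\ge 0$ means symmetric positive semidefinite. Then: 1. This is a convex optimization problem: its feasible set is convex, the $2\times2$ block matrix in the objective is positive definite at every feasible point, and the objective is concave on the feasible set. 2. The maxima $R_{n,\max}(P)$ and $C_n(P)$ and the maximum of the program are attained and finite, $C_n(P)$ equals the optimal value of the program, and $$R_{n,\max}(P)\le C_n(P).$$ -/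

import Mathlib

open MeasureTheory ProbabilityTheory InformationTheory Matrix
open scoped ENNReal NNReal

noncomputable section

namespace NoisyFeedback

section Information

variable {Ω α β γ : Type*} [MeasurableSpace Ω] [MeasurableSpace α] [MeasurableSpace β]
  [MeasurableSpace γ]

/-- Mutual information `I(X; Y)` in bits: the relative entropy of the joint law with respect to the
product of the marginal laws. -/
def mutualInfo (X : Ω → α) (Y : Ω → β) (μ : Measure Ω) : ℝ≥0∞ :=
  klDiv (μ.map fun ω => (X ω, Y ω)) ((μ.map X).prod (μ.map Y)) / ENNReal.ofReal (Real.log 2)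

/-- Conditional mutual information `I(X; Y | Z)` in bits: the relative entropy of the joint law
`P_{ZXY}` with respect to `P_Z ⊗ (P_{X|Z} × P_{Y|Z})`. -/
def condMutualInfo [StandardBorelSpace α] [Nonempty α] [StandardBorelSpace β] [Nonempty β]
    (X : Ω → α) (Y : Ω → β) (Z : Ω → γ) (μ : Measure Ω) [IsFiniteMeasure μ] : ℝ≥0∞ :=
  klDiv (μ.map fun ω => (Z ω, X ω, Y ω))
    ((μ.map Z) ⊗ₘ (condDistrib X Z μ ×ₖ condDistrib Y Z μ)) / ENNReal.ofReal (Real.log 2)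

/-- Conditional directed information
`I(X^n → Y^n | V) = ∑_i I(X^i; Y_i | Y^{i-1}, V)` in bits. -/
def condDirectedInfo {n : ℕ} (X Y : Ω → Fin n → ℝ) (V : Ω → γ) (μ : Measure Ω)
    [IsFiniteMeasure μ] : ℝ≥0∞ :=
  ∑ i : Fin n, condMutualInfo
    (fun ω (j : {j : Fin n // j ≤ i}) => X ω j)
    (fun ω => Y ω i)
    (fun ω => ((fun j : {j : Fin n // j < i} => Y ω j), V ω)) μ

end Information

variable {n : ℕ}

/-- Realizations `(s, w, v)` of the message vector, the forward noise and the feedback noise. -/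
abbrev Sample (n : ℕ) : Type :=
  EuclideanSpace ℝ (Fin n) × EuclideanSpace ℝ (Fin n) × EuclideanSpace ℝ (Fin n)

/-- The joint law of the independent vectors `s ∼ N(0, Ks)`, `w ∼ N(0, Kw)`, `v ∼ N(0, Kv)`. -/
def law (Ks Kw Kv : Matrix (Fin n) (Fin n) ℝ) : Measure (Sample n) :=
  (multivariateGaussian 0 Ks).prod ((multivariateGaussian 0 Kw).prod (multivariateGaussian 0 Kv))

instance (Ks Kw Kv : Matrix (Fin n) (Fin n) ℝ) : IsProbabilityMeasure (law Ks Kw Kv) := by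
  unfold law
  infer_instance

/-- The message vector `s`. -/
def message (ω : Sample n) : Fin n → ℝ := ω.1.ofLp

/-- The forward noise `w`. -/
def forwardNoise (ω : Sample n) : Fin n → ℝ := ω.2.1.ofLp

/-- The feedback noise `v`. -/
def feedbackNoise (ω : Sample n) : Fin n → ℝ := ω.2.2.ofLp

/-- The channel input `x = s + B (w + v)`. -/
def input (B : Matrix (Fin n) (Fin n) ℝ) (ω : Sample n) : Fin n → ℝ :=
  message ω + B *ᵥ (forwardNoise ω + feedbackNoise ω)

/-- The channel output `y = s + B (w + v) + w`. -/
def output (B : Matrix (Fin n) (Fin n) ℝ) (ω : Sample n) : Fin n → ℝ :=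
  input B ω + forwardNoise ω

/-- The covariance matrix `K_x` of the channel input. -/
def inputCov (B Ks Kw Kv : Matrix (Fin n) (Fin n) ℝ) : Matrix (Fin n) (Fin n) ℝ :=
  Matrix.of fun i j => covariance (fun ω => input B ω i) (fun ω => input B ω j) (law Ks Kw Kv)

def IsStrictlyLower (B : Matrix (Fin n) (Fin n) ℝ) : Prop :=
  ∀ i j, i ≤ j → B i j = 0

/-- The `n`-block rate `(1/n) I(S^n; Y^n)` of the linear scheme `(B, Ks)`. -/
def rate (B Ks Kw Kv : Matrix (Fin n) (Fin n) ℝ) : ℝ≥0∞ :=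
  mutualInfo message (output B) (law Ks Kw Kv) / n

/-- `(1/n) I(X^n → Y^n | V^n)` for the linear scheme `(B, Ks)`. -/
def directedRate (B Ks Kw Kv : Matrix (Fin n) (Fin n) ℝ) : ℝ≥0∞ :=
  condDirectedInfo (input B) (output B) feedbackNoise (law Ks Kw Kv) / n

/-- The rates of all linear schemes `(B, Ks)` that meet the power constraint
`tr (Ks + B (Kw + Kv) Bᵀ) ≤ n P`. -/
def achievableRates (Kw Kv : Matrix (Fin n) (Fin n) ℝ) (P : ℝ) : Set ℝ≥0∞ :=
  {r | ∃ B Ks : Matrix (Fin n) (Fin n) ℝ, IsStrictlyLower B ∧ Ks.PosSemidef ∧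
    (Ks + B * (Kw + Kv) * Bᵀ).trace ≤ n * P ∧ r = rate B Ks Kw Kv}

/-- The values of `(1/n) I(X^n → Y^n | V^n)` over all `(B, Ks)` with `tr K_x ≤ n P`. -/
def directedRates (Kw Kv : Matrix (Fin n) (Fin n) ℝ) (P : ℝ) : Set ℝ≥0∞ :=
  {r | ∃ B Ks : Matrix (Fin n) (Fin n) ℝ, IsStrictlyLower B ∧ Ks.PosSemidef ∧
    (inputCov B Ks Kw Kv).trace ≤ n * P ∧ r = directedRate B Ks Kw Kv}

/-- The matrix `[Kv⁻¹, Bᵀ; B, H]`. -/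
def objectiveBlock (Kv H B : Matrix (Fin n) (Fin n) ℝ) :
    Matrix (Fin n ⊕ Fin n) (Fin n ⊕ Fin n) ℝ :=
  fromBlocks Kv⁻¹ Bᵀ B H

/-- The matrix `[H, I + B, B; I + Bᵀ, Kw⁻¹, 0; Bᵀ, 0, Kv⁻¹]`. -/
def constraintBlock (Kw Kv H B : Matrix (Fin n) (Fin n) ℝ) :
    Matrix (Fin n ⊕ Fin n ⊕ Fin n) (Fin n ⊕ Fin n ⊕ Fin n) ℝ :=
  fromBlocks H (fromCols (1 + B) B) (fromRows (1 + Bᵀ) Bᵀ) (fromBlocks Kw⁻¹ 0 0 Kv⁻¹)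

/-- The feasible pairs `(H, B)` of the max-det program. -/
def feasible (Kw Kv : Matrix (Fin n) (Fin n) ℝ) (P : ℝ) :
    Set (Matrix (Fin n) (Fin n) ℝ × Matrix (Fin n) (Fin n) ℝ) :=
  {p | (p.1 - Kw * p.2ᵀ - p.2 * Kw - Kw).trace ≤ n * P ∧
    (constraintBlock Kw Kv p.1 p.2).PosSemidef ∧ IsStrictlyLower p.2}

/-- The objective of the max-det program. -/
def objective (Kw Kv : Matrix (Fin n) (Fin n) ℝ)
    (p : Matrix (Fin n) (Fin n) ℝ × Matrix (Fin n) (Fin n) ℝ) : ℝ :=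
  1 / (2 * n) * Real.logb 2 (objectiveBlock Kv p.1 p.2).det
    - 1 / (2 * n) * Real.logb 2 (Kv⁻¹ * Kw).det

end NoisyFeedback

end

/-!
Both information quantities reduce to ratios of determinants. The message `s` and the total noise
`y - s` are independent Gaussian vectors, so `I(S; Y)` is half the logarithm of
`det (K_s + K_z) / det K_z`, where `K_z = (1 + B) K_w (1 + B)ᵀ + B K_v Bᵀ`. For the directed
information, a unit lower triangular matrix that diagonalizes the covariance of `y - B v`, and one
that diagonalizes `K_w`, produce the prediction errors of `y_i` without and with knowledge of `x^i`.
These errors are independent of the data they are predicted from, so each conditional term is a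
difference of two scalar Gaussian entropies. The error variances multiply to the determinants, so
the sum is half the logarithm of `det (K_s + (1 + B) K_w (1 + B)ᵀ) / det K_w`.

Since `det (1 + B) = 1`, the second ratio is the first one without the term `B K_v Bᵀ`; the
inequality holds because `det (X + S) / det X` decreases as `X` increases. Two Schur complements and
the substitution `H = K_s + K_z` turn the maximization of the directed information into the program.
-/

noncomputable section

namespace NoisyFeedback

section LogDet

variable {ι : Type*}

lemma convex_setOf_posSemidef : Convex ℝ {X : Matrix ι ι ℝ | X.PosSemidef} :=
  fun _ hX _ hY _ _ ha hb _ => (PosSemidef.smul hX ha).add (PosSemidef.smul hY hb)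

lemma convex_setOf_posDef : Convex ℝ {X : Matrix ι ι ℝ | X.PosDef} :=
  convex_iff_forall_pos.2 fun _ hX _ hY _ _ ha hb _ => (PosDef.smul hX ha).add (PosDef.smul hY hb)

variable [Fintype ι]

open scoped MatrixOrder in
lemma exists_eq_mul_transpose {X : Matrix ι ι ℝ} (hX : X.PosSemidef) :
    ∃ G : Matrix ι ι ℝ, X = G * Gᵀ := by
  classical
  obtain ⟨G, rfl⟩ := CStarAlgebra.nonneg_iff_eq_star_mul_self.mp hX.nonneg
  exact ⟨Gᵀ, by simp [star_eq_conjTranspose]⟩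

lemma trace_mul_nonneg {X Y : Matrix ι ι ℝ} (hX : X.PosSemidef) (hY : Y.PosSemidef) :
    0 ≤ (X * Y).trace := by
  obtain ⟨G, rfl⟩ := exists_eq_mul_transpose hX
  have h := (hY.conjTranspose_mul_mul_same G).trace_nonneg
  rwa [conjTranspose_eq_transpose_of_trivial, trace_mul_cycle] at h

variable [DecidableEq ι]

lemma exists_isUnit_eq_mul_transpose {X : Matrix ι ι ℝ} (hX : X.PosDef) :
    ∃ G : Matrix ι ι ℝ, IsUnit G ∧ X = G * Gᵀ := by
  obtain ⟨G, rfl⟩ := exists_eq_mul_transpose hX.posSemidef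
  have h := hX.det_pos.ne'
  rw [det_mul] at h
  exact ⟨G, (isUnit_iff_isUnit_det _).2 (left_ne_zero_of_mul h).isUnit, rfl⟩

lemma log_det_le_trace_sub_card {X : Matrix ι ι ℝ} (hX : X.PosDef) :
    Real.log X.det ≤ X.trace - Fintype.card ι := by
  have hdet : X.det = ∏ i, hX.isHermitian.eigenvalues i := by
    simpa using hX.isHermitian.det_eq_prod_eigenvalues
  have htrace : X.trace = ∑ i, hX.isHermitian.eigenvalues i := by
    simpa using hX.isHermitian.trace_eq_sum_eigenvalues
  rw [hdet, htrace, Real.log_prod fun i _ => (hX.eigenvalues_pos i).ne']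
  calc ∑ i, Real.log (hX.isHermitian.eigenvalues i)
      ≤ ∑ i, (hX.isHermitian.eigenvalues i - 1) :=
        Finset.sum_le_sum fun i _ => Real.log_le_sub_one_of_pos (hX.eigenvalues_pos i)
    _ = ∑ i, hX.isHermitian.eigenvalues i - Fintype.card ι := by simp

lemma log_det_le_log_det_add_trace {X Y : Matrix ι ι ℝ} (hX : X.PosDef) (hY : Y.PosDef) :
    Real.log X.det ≤ Real.log Y.det + (Y⁻¹ * (X - Y)).trace := by
  obtain ⟨G, hG, hYG⟩ := exists_isUnit_eq_mul_transpose hY.inv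
  have hpos : (Gᵀ * X * G).PosDef := by
    simpa using hX.conjTranspose_mul_mul_same (B := G) (mulVec_injective_of_isUnit hG)
  have hdet : (Gᵀ * X * G).det = Y.det⁻¹ * X.det := by
    rw [← Ring.inverse_eq_inv', ← det_nonsing_inv, hYG, det_mul, det_mul, det_mul]
    ring
  have htrace : (Gᵀ * X * G).trace = (Y⁻¹ * X).trace := by
    rw [hYG, trace_mul_cycle]
  have hone : (Y⁻¹ * Y).trace = Fintype.card ι := by
    rw [nonsing_inv_mul _ ((isUnit_iff_isUnit_det _).1 hY.isUnit), trace_one]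
  have h := log_det_le_trace_sub_card hpos
  rw [hdet, htrace, Real.log_mul (inv_ne_zero hY.det_pos.ne') hX.det_pos.ne', Real.log_inv] at h
  rw [Matrix.mul_sub, trace_sub, hone]
  linarith

lemma concaveOn_log_det :
    ConcaveOn ℝ {X : Matrix ι ι ℝ | X.PosDef} fun X => Real.log X.det := by
  refine ⟨convex_setOf_posDef, fun X hX Y hY a b ha hb hab => ?_⟩
  have hZ := convex_setOf_posDef hX hY ha hb hab
  set Z := a • X + b • Y with hZ_def
  have hX_le := mul_le_mul_of_nonneg_left (log_det_le_log_det_add_trace hX hZ) ha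
  have hY_le := mul_le_mul_of_nonneg_left (log_det_le_log_det_add_trace hY hZ) hb
  have hcancel : a * (Z⁻¹ * (X - Z)).trace + b * (Z⁻¹ * (Y - Z)).trace = 0 := by
    have hcomb : a • (X - Z) + b • (Y - Z) = 0 := by
      calc a • (X - Z) + b • (Y - Z) = Z - (a + b) • Z := by rw [hZ_def]; module
        _ = 0 := by rw [hab, one_smul, sub_self]
    simpa [Matrix.mul_add] using congrArg (fun W => (Z⁻¹ * W).trace) hcomb
  calc a * Real.log X.det + b * Real.log Y.det
      ≤ (a + b) * Real.log Z.det := by linarith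
    _ = Real.log Z.det := by rw [hab, one_mul]

lemma det_le_det_of_posSemidef_sub {X Y : Matrix ι ι ℝ} (hX : X.PosDef)
    (h : (Y - X).PosSemidef) : X.det ≤ Y.det := by
  have hY : Y.PosDef := by simpa using hX.add_posSemidef h
  have htangent := log_det_le_log_det_add_trace hX hY
  have htrace := trace_mul_nonneg hY.inv.posSemidef h
  rw [← neg_sub Y X, Matrix.mul_neg, trace_neg] at htangent
  exact (Real.log_le_log_iff hX.det_pos hY.det_pos).1 (by linarith)

-- Both sides are Schur complements of the block matrix `[X⁻¹, 1; 1, Y]`.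
lemma posSemidef_inv_sub_inv {X Y : Matrix ι ι ℝ} (hX : X.PosDef) (h : (Y - X).PosSemidef) :
    (X⁻¹ - Y⁻¹).PosSemidef := by
  have hY : Y.PosDef := by simpa using hX.add_posSemidef h
  have := hX.inv.isUnit.invertible
  have := hY.isUnit.invertible
  have := hX.isUnit.invertible
  have hblock := (PosDef.fromBlocks₂₂ Y 1 hX.inv).2 (by simpa using h)
  simpa using (PosDef.fromBlocks₁₁ 1 X⁻¹ hY).1 hblock

lemma det_add_div_det_le_of_posSemidef_sub {X Y S : Matrix ι ι ℝ} (hX : X.PosDef)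
    (h : (Y - X).PosSemidef) (hS : S.PosSemidef) :
    (Y + S).det / Y.det ≤ (X + S).det / X.det := by
  have hY : Y.PosDef := by simpa using hX.add_posSemidef h
  obtain ⟨C, rfl⟩ := exists_eq_mul_transpose hS
  have hratio : ∀ {Z : Matrix ι ι ℝ}, Z.PosDef →
      (Z + C * Cᵀ).det / Z.det = (1 + Cᵀ * Z⁻¹ * C).det := fun hZ => by
    rw [det_add_mul _ _ hZ.det_pos.ne'.isUnit, mul_div_cancel_left₀ _ hZ.det_pos.ne']
  rw [hratio hX, hratio hY]
  refine det_le_det_of_posSemidef_sub ?_ ?_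
  · have := hY.inv.posSemidef.conjTranspose_mul_mul_same C
    exact PosDef.one.add_posSemidef (by simpa using this)
  · have := (posSemidef_inv_sub_inv hX h).conjTranspose_mul_mul_same C
    rw [conjTranspose_eq_transpose_of_trivial, Matrix.mul_sub, Matrix.sub_mul] at this
    simpa using this

end LogDet

section Triangular

variable {n : ℕ}

lemma det_one_add_of_isStrictlyLower {B : Matrix (Fin n) (Fin n) ℝ} (hB : IsStrictlyLower B) :
    (1 + B).det = 1 := by
  rw [det_of_isLowerTriangular]
  · simp [hB _ _ le_rfl]
  · intro i j (hij : i < j)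
    simp [hij.ne, hB _ _ hij.le]

lemma isUnit_one_add_of_isStrictlyLower {B : Matrix (Fin n) (Fin n) ℝ} (hB : IsStrictlyLower B) :
    IsUnit (1 + B) :=
  (isUnit_iff_isUnit_det _).2 (by simp [det_one_add_of_isStrictlyLower hB])

lemma exists_isStrictlyLower_one_add_eq_diagonal_mul {L : Matrix (Fin n) (Fin n) ℝ}
    (hL : ∀ i j, i < j → L i j = 0) (hdet : L.det ≠ 0) :
    ∃ M, IsStrictlyLower M ∧ 1 + M = diagonal (fun i => (L i i)⁻¹) * L := by
  have hdiag : ∀ i, L i i ≠ 0 := by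
    rw [det_of_isLowerTriangular L fun i j hij => hL i j hij] at hdet
    exact fun i => Finset.prod_ne_zero_iff.1 hdet i (Finset.mem_univ i)
  refine ⟨diagonal (fun i => (L i i)⁻¹) * L - 1, fun i j hij => ?_, add_sub_cancel _ _⟩
  rcases hij.eq_or_lt with rfl | hij
  · simp [hdiag]
  · simp [hL i j hij, hij.ne]

lemma exists_isStrictlyLower_mul_mul_transpose_eq_diagonal {K : Matrix (Fin n) (Fin n) ℝ}
    (hK : K.PosDef) :
    ∃ (M : Matrix (Fin n) (Fin n) ℝ) (d : Fin n → ℝ),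
      IsStrictlyLower M ∧ (∀ i, 0 < d i) ∧ (1 + M) * K * (1 + M)ᵀ = diagonal d := by
  set L := LDL.lowerInv hK
  have hdet : L.det ≠ 0 := ((isUnit_iff_isUnit_det _).1 (isUnit_of_invertible L)).ne_zero
  have hconj : L * K * Lᵀ = diagonal (LDL.diagEntries hK) := by
    simpa [LDL.diag] using (LDL.diag_eq_lowerInv_conj hK).symm
  obtain ⟨M, hM, hML⟩ := exists_isStrictlyLower_one_add_eq_diagonal_mul (L := L)
    (fun i j hij => LDL.lowerInv_triangular hK hij) hdet
  set e : Fin n → ℝ := fun i => (L i i)⁻¹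
  have hdiag : (1 + M) * K * (1 + M)ᵀ =
      diagonal fun i => e i * LDL.diagEntries hK i * e i := by
    calc (1 + M) * K * (1 + M)ᵀ = diagonal e * (L * K * Lᵀ) * (diagonal e)ᵀ := by
          simp only [hML, transpose_mul, Matrix.mul_assoc]
      _ = _ := by simp only [hconj, diagonal_transpose, diagonal_mul_diagonal]
  refine ⟨M, _, hM, posDef_diagonal_iff.1 ?_, hdiag⟩
  rw [← hdiag]
  simpa using hK.mul_mul_conjTranspose_same (B := 1 + M)
    (vecMul_injective_of_isUnit (isUnit_one_add_of_isStrictlyLower hM))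

lemma det_eq_prod_of_mul_mul_transpose_eq_diagonal {K M : Matrix (Fin n) (Fin n) ℝ}
    {d : Fin n → ℝ} (hM : IsStrictlyLower M) (h : (1 + M) * K * (1 + M)ᵀ = diagonal d) :
    K.det = ∏ i, d i := by
  have := congrArg det h
  rwa [det_mul, det_mul, det_transpose, det_one_add_of_isStrictlyLower hM, one_mul, mul_one,
    det_diagonal] at this

lemma mul_apply_eq_zero_of_mul_mul_transpose_eq_diagonal {K M : Matrix (Fin n) (Fin n) ℝ}
    {d : Fin n → ℝ} (hM : IsStrictlyLower M) (h : (1 + M) * K * (1 + M)ᵀ = diagonal d)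
    {i j : Fin n} (hij : j < i) : ((1 + M) * K) i j = 0 := by
  have hunit := (isUnit_iff_isUnit_det _).1 (isUnit_one_add_of_isStrictlyLower hM)
  have := invertibleOfIsUnitDet _ hunit
  have hlower : (1 + M).BlockTriangular OrderDual.toDual := by
    intro a b (hab : a < b)
    simp [hab.ne, hM _ _ hab.le]
  have hinv := blockTriangular_inv_of_blockTriangular hlower
  have hmul : (1 + M) * K = diagonal d * ((1 + M)⁻¹)ᵀ := by
    rw [← h, Matrix.mul_assoc _ (1 + M)ᵀ, ← transpose_mul, nonsing_inv_mul _ hunit, transpose_one,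
      Matrix.mul_one]
  rw [hmul, diagonal_mul, transpose_apply, hinv (i := j) (j := i) hij, mul_zero]

end Triangular

section DiffEntropy

variable {Ω α β γ : Type*} {mΩ : MeasurableSpace Ω} [MeasurableSpace α] [MeasurableSpace β]
  [MeasurableSpace γ] {μ : Measure Ω}

/-- `P` has differential entropy `h` (in nats) relative to the reference measure `ν`, with a density
that is everywhere positive. The density is given through its logarithm, so that its positivity
needs no separate condition. -/
def HasDiffEntropy (P ν : Measure α) (h : ℝ) : Prop :=
  ∃ ℓ : α → ℝ, Measurable ℓ ∧ P = ν.withDensity (fun x => ENNReal.ofReal (Real.exp (ℓ x))) ∧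
    Integrable ℓ P ∧ ∫ x, ℓ x ∂P = -h

lemma klDiv_withDensity_exp {m P Q : Measure α} [IsProbabilityMeasure P] [IsProbabilityMeasure Q]
    {p q : α → ℝ} (hp : Measurable p) (hq : Measurable q)
    (hP : P = m.withDensity fun x => ENNReal.ofReal (Real.exp (p x)))
    (hQ : Q = m.withDensity fun x => ENNReal.ofReal (Real.exp (q x)))
    (hint : Integrable (fun x => p x - q x) P) :
    0 ≤ ∫ x, (p x - q x) ∂P ∧ klDiv P Q = ENNReal.ofReal (∫ x, (p x - q x) ∂P) := by
  have hPQ : P = Q.withDensity fun x => ENNReal.ofReal (Real.exp (p x - q x)) := by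
    rw [hP, hQ, ← withDensity_mul _ (by fun_prop) (by fun_prop)]
    congr 1 with x
    rw [Pi.mul_apply, ← ENNReal.ofReal_mul (Real.exp_nonneg _), ← Real.exp_add, add_sub_cancel]
  have hac : P ≪ Q := hPQ ▸ withDensity_absolutelyContinuous _ _
  have hllr : llr P Q =ᵐ[P] fun x => p x - q x := by
    have hrnDeriv : P.rnDeriv Q =ᵐ[Q] fun x => ENNReal.ofReal (Real.exp (p x - q x)) := by
      conv_lhs => rw [hPQ]
      exact Measure.rnDeriv_withDensity Q (by fun_prop)
    filter_upwards [hac.ae_le hrnDeriv] with x hx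
    rw [llr, hx, ENNReal.toReal_ofReal (Real.exp_nonneg _), Real.log_exp]
  have hkl := klDiv_of_ac_of_integrable hac (hint.congr hllr.symm)
  have hnonneg := integral_llr_add_sub_measure_univ_nonneg hac (hint.congr hllr.symm)
  rw [integral_congr_ae hllr] at hkl hnonneg
  simp only [probReal_univ, add_sub_cancel_right] at hkl hnonneg
  exact ⟨hnonneg, hkl⟩

lemma klDiv_map_measurableEquiv (e : α ≃ᵐ β) (P Q : Measure α) [IsFiniteMeasure P]
    [IsFiniteMeasure Q] : klDiv (P.map e) (Q.map e) = klDiv P Q := by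
  refine le_antisymm (klDiv_map_le _ _ e.measurable) ?_
  simpa using klDiv_map_le (P.map e) (Q.map e) e.symm.measurable

lemma map_withDensity_comp {f : α → β} (hf : Measurable f) (m : Measure α) {r : β → ℝ≥0∞}
    (hr : Measurable r) :
    (m.withDensity fun x => r (f x)).map f = (m.map f).withDensity r := by
  ext s hs
  rw [Measure.map_apply hf hs, withDensity_apply _ (hf hs), withDensity_apply _ hs,
    setLIntegral_map hs hr hf]

lemma compProd_condDistrib_prod [StandardBorelSpace α] [Nonempty α] [IsFiniteMeasure μ]
    {X : Ω → α} (hX : AEMeasurable X μ) (Z : Ω → β) (κ : Kernel β γ) [IsSFiniteKernel κ] :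
    μ.map Z ⊗ₘ (condDistrib X Z μ ×ₖ κ) =
      (μ.map (fun ω => (Z ω, X ω)) ⊗ₘ κ.prodMkRight α).map MeasurableEquiv.prodAssoc := by
  rw [← compProd_map_condDistrib hX, Measure.compProd_assoc']
  congr 1
  ext z s hs
  rw [Kernel.compProd_apply hs, Kernel.prod_apply, Measure.prod_apply hs]
  rfl

end DiffEntropy

section AdditiveNoise

variable {Ω α β G : Type*} {mΩ : MeasurableSpace Ω} [MeasurableSpace α] [MeasurableSpace β]
  [MeasurableSpace G] [AddCommGroup G]

/-- The additive noise channel that sends `u` to `f u + e`, where the noise `e` has law `σ`.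
For a non-measurable `f` it is the junk value `0` of `Kernel.map`. -/
def additiveNoiseKernel (f : β → G) (σ : Measure G) : Kernel β G :=
  (Kernel.id ×ₖ Kernel.const β σ).map fun x => x.2 + f x.1

variable [MeasurableAdd₂ G] {f g : β → G} {σ : Measure G} {μ : Measure Ω}

lemma isMarkovKernel_additiveNoiseKernel [IsProbabilityMeasure σ] (hf : Measurable f) :
    IsMarkovKernel (additiveNoiseKernel f σ) :=
  Kernel.IsMarkovKernel.map _ (by fun_prop)

lemma additiveNoiseKernel_apply [SFinite σ] (hf : Measurable f) (u : β) :
    additiveNoiseKernel f σ u = σ.map fun e => e + f u := by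
  rw [additiveNoiseKernel, Kernel.map_apply _ (by fun_prop), Kernel.prod_apply, Kernel.id_apply,
    Kernel.const_apply, Measure.dirac_prod, Measure.map_map (by fun_prop) (by fun_prop)]
  rfl

lemma prodMkRight_additiveNoiseKernel [SFinite σ] (hf : Measurable f) :
    (additiveNoiseKernel f σ).prodMkRight α = additiveNoiseKernel (f ∘ Prod.fst) σ := by
  ext1 x
  rw [Kernel.prodMkRight_apply, additiveNoiseKernel_apply hf,
    additiveNoiseKernel_apply (hf.comp measurable_fst), Function.comp_apply]

lemma compProd_additiveNoiseKernel [IsProbabilityMeasure σ] (hf : Measurable f) (ρ : Measure β)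
    [SFinite ρ] :
    ρ ⊗ₘ additiveNoiseKernel f σ = (ρ.prod σ).map fun x => (x.1, x.2 + f x.1) := by
  have := isMarkovKernel_additiveNoiseKernel (σ := σ) hf
  refine Measure.ext_of_lintegral _ fun φ hφ => ?_
  rw [lintegral_map hφ (by fun_prop), lintegral_prod _ (by fun_prop),
    Measure.lintegral_compProd hφ]
  refine lintegral_congr fun u => ?_
  rw [additiveNoiseKernel_apply hf, lintegral_map (by fun_prop) (by fun_prop)]

lemma compProd_additiveNoiseKernel_withDensity {ν : Measure G} [SFinite ν]
    [ν.IsAddRightInvariant] [MeasurableSub₂ G] [IsProbabilityMeasure σ] (hf : Measurable f)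
    {r : G → ℝ≥0∞} (hr : Measurable r) (hσ : σ = ν.withDensity r) (ρ : Measure β) [SFinite ρ] :
    ρ ⊗ₘ additiveNoiseKernel f σ = (ρ.prod ν).withDensity fun x => r (x.2 - f x.1) := by
  have hshift : MeasurePreserving (fun x : β × G => (x.1, x.2 + f x.1)) (ρ.prod ν) (ρ.prod ν) :=
    (MeasurePreserving.id _).skew_product (g := fun u t => t + f u)
      (by unfold Function.uncurry; fun_prop) (ae_of_all _ fun u => map_add_right_eq_self ν (f u))
  rw [compProd_additiveNoiseKernel hf, hσ, prod_withDensity_right hr]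
  conv_rhs =>
    rw [← hshift.map_eq, ← map_withDensity_comp hshift.measurable _ (by fun_prop)]
  simp only [add_sub_cancel_right]

lemma map_prodMk_eq_compProd_additiveNoiseKernel [MeasurableSub₂ G] [IsProbabilityMeasure μ]
    {U : Ω → β} {Y : Ω → G} (hU : Measurable U) (hY : Measurable Y) (hf : Measurable f)
    (hind : IndepFun U (fun ω => Y ω - f (U ω)) μ) :
    μ.map (fun ω => (U ω, Y ω)) =
      μ.map U ⊗ₘ additiveNoiseKernel f (μ.map fun ω => Y ω - f (U ω)) := by
  have hnoise : Measurable fun ω => Y ω - f (U ω) := by fun_prop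
  have := Measure.isProbabilityMeasure_map (μ := μ) hnoise.aemeasurable
  rw [compProd_additiveNoiseKernel hf,
    ← hind.map_prod_eq_prod_map_map hU.aemeasurable hnoise.aemeasurable,
    Measure.map_map (by fun_prop) (hU.prodMk hnoise)]
  simp only [Function.comp_def, sub_add_cancel]

lemma condDistrib_ae_eq_additiveNoiseKernel [MeasurableSub₂ G] [StandardBorelSpace G]
    [IsProbabilityMeasure μ] {U : Ω → β} {Y : Ω → G} (hU : Measurable U) (hY : Measurable Y)
    (hf : Measurable f) (hind : IndepFun U (fun ω => Y ω - f (U ω)) μ) :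
    condDistrib Y U μ =ᵐ[μ.map U] additiveNoiseKernel f (μ.map fun ω => Y ω - f (U ω)) := by
  have hnoise : Measurable fun ω => Y ω - f (U ω) := by fun_prop
  have := Measure.isProbabilityMeasure_map (μ := μ) hnoise.aemeasurable
  have := isMarkovKernel_additiveNoiseKernel (σ := μ.map fun ω => Y ω - f (U ω)) hf
  exact condDistrib_ae_eq_of_measure_eq_compProd U hY.aemeasurable
    (map_prodMk_eq_compProd_additiveNoiseKernel hU hY hf hind)

section Entropy

variable [MeasurableSub₂ G] {ν : Measure G} [SFinite ν] [ν.IsAddRightInvariant]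
  [IsProbabilityMeasure μ]

lemma klDiv_map_prodMk_additiveNoiseKernel {U : Ω → β} {Y : Ω → G} {a b : ℝ}
    (hU : Measurable U) (hY : Measurable Y) (hf : Measurable f) (hg : Measurable g)
    (hind : IndepFun U (fun ω => Y ω - g (U ω)) μ)
    (ha : HasDiffEntropy (μ.map fun ω => Y ω - f (U ω)) ν a)
    (hb : HasDiffEntropy (μ.map fun ω => Y ω - g (U ω)) ν b) :
    b ≤ a ∧ klDiv (μ.map fun ω => (U ω, Y ω))
      (μ.map U ⊗ₘ additiveNoiseKernel f (μ.map fun ω => Y ω - f (U ω))) =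
        ENNReal.ofReal (a - b) := by
  have hf' : Measurable fun ω => Y ω - f (U ω) := by fun_prop
  have hg' : Measurable fun ω => Y ω - g (U ω) := by fun_prop
  have := Measure.isProbabilityMeasure_map (μ := μ) hU.aemeasurable
  have := Measure.isProbabilityMeasure_map (μ := μ) hf'.aemeasurable
  have := Measure.isProbabilityMeasure_map (μ := μ) hg'.aemeasurable
  have := Measure.isProbabilityMeasure_map (μ := μ) (hU.prodMk hY).aemeasurable
  have := isMarkovKernel_additiveNoiseKernel (σ := μ.map fun ω => Y ω - f (U ω)) hf
  obtain ⟨p, hp, hPp, hpint, hpa⟩ := ha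
  obtain ⟨q, hq, hQq, hqint, hqb⟩ := hb
  rw [integrable_map_measure (by fun_prop) (by fun_prop)] at hpint hqint
  rw [integral_map (by fun_prop) (by fun_prop)] at hpa hqb
  have hjoint := map_prodMk_eq_compProd_additiveNoiseKernel hU hY hg hind
  rw [compProd_additiveNoiseKernel_withDensity hg (by fun_prop) hQq] at hjoint
  have hint : Integrable (fun x : β × G => q (x.2 - g x.1) - p (x.2 - f x.1))
      (μ.map fun ω => (U ω, Y ω)) := by
    rw [integrable_map_measure (by fun_prop) (by fun_prop)]
    exact hqint.sub hpint
  have hvalue : ∫ x, (q (x.2 - g x.1) - p (x.2 - f x.1)) ∂μ.map (fun ω => (U ω, Y ω)) = a - b := by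
    rw [integral_map (by fun_prop) (by fun_prop)]
    calc ∫ ω, (q (Y ω - g (U ω)) - p (Y ω - f (U ω))) ∂μ = -b - -a := by
          rw [← hqb, ← hpa]
          exact integral_sub hqint hpint
      _ = a - b := by ring
  have hkl := klDiv_withDensity_exp (by fun_prop) (by fun_prop) hjoint
    (compProd_additiveNoiseKernel_withDensity hf (by fun_prop) hPp _) hint
  rw [hvalue] at hkl
  exact ⟨sub_nonneg.1 hkl.1, hkl.2⟩

lemma mutualInfo_eq_ofReal {U : Ω → β} {Y : Ω → G} {a b : ℝ}
    (hU : Measurable U) (hY : Measurable Y) (hg : Measurable g)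
    (hind : IndepFun U (fun ω => Y ω - g (U ω)) μ) (ha : HasDiffEntropy (μ.map Y) ν a)
    (hb : HasDiffEntropy (μ.map fun ω => Y ω - g (U ω)) ν b) :
    mutualInfo U Y μ = ENNReal.ofReal (a - b) / ENNReal.ofReal (Real.log 2) := by
  have := Measure.isProbabilityMeasure_map (μ := μ) hY.aemeasurable
  have hprod : (μ.map U).prod (μ.map Y) =
      μ.map U ⊗ₘ additiveNoiseKernel (fun _ => 0) (μ.map Y) := by
    simp [compProd_additiveNoiseKernel measurable_const]
  have hkl := klDiv_map_prodMk_additiveNoiseKernel hU hY (measurable_const (a := (0 : G))) hg hind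
    (by simpa only [sub_zero] using ha) hb
  simp only [sub_zero, ← hprod] at hkl
  rw [mutualInfo, hkl.2]

lemma condMutualInfo_eq_ofReal [StandardBorelSpace α] [Nonempty α] [StandardBorelSpace G]
    {X : Ω → α} {Y : Ω → G} {Z : Ω → β} {g : β × α → G} {a b : ℝ}
    (hX : Measurable X) (hY : Measurable Y) (hZ : Measurable Z) (hf : Measurable f)
    (hg : Measurable g) (hindZ : IndepFun Z (fun ω => Y ω - f (Z ω)) μ)
    (hindZX : IndepFun (fun ω => (Z ω, X ω)) (fun ω => Y ω - g (Z ω, X ω)) μ)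
    (ha : HasDiffEntropy (μ.map fun ω => Y ω - f (Z ω)) ν a)
    (hb : HasDiffEntropy (μ.map fun ω => Y ω - g (Z ω, X ω)) ν b) :
    b ≤ a ∧ condMutualInfo X Y Z μ =
      ENNReal.ofReal (a - b) / ENNReal.ofReal (Real.log 2) := by
  have hnoise : Measurable fun ω => Y ω - f (Z ω) := by fun_prop
  have := Measure.isProbabilityMeasure_map (μ := μ) hnoise.aemeasurable
  have := isMarkovKernel_additiveNoiseKernel (σ := μ.map fun ω => Y ω - f (Z ω)) hf
  have hZX := hZ.prodMk hX
  have hkl := klDiv_map_prodMk_additiveNoiseKernel hZX hY (hf.comp measurable_fst) hg hindZX ha hb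
  have hjoint : μ.map (fun ω => (Z ω, X ω, Y ω)) =
      (μ.map fun ω => ((Z ω, X ω), Y ω)).map MeasurableEquiv.prodAssoc := by
    rw [Measure.map_map (MeasurableEquiv.measurable _) (hZX.prodMk hY)]
    rfl
  have hcond : condDistrib X Z μ ×ₖ condDistrib Y Z μ =ᵐ[μ.map Z]
      condDistrib X Z μ ×ₖ additiveNoiseKernel f (μ.map fun ω => Y ω - f (Z ω)) := by
    filter_upwards [condDistrib_ae_eq_additiveNoiseKernel hZ hY hf hindZ] with z hz
    rw [Kernel.prod_apply, Kernel.prod_apply, hz]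
  have := isMarkovKernel_additiveNoiseKernel (σ := μ.map fun ω => Y ω - f (Z ω))
    (hf.comp (measurable_fst (β := α)))
  rw [condMutualInfo, hjoint, Measure.compProd_congr hcond,
    compProd_condDistrib_prod hX.aemeasurable, klDiv_map_measurableEquiv,
    prodMkRight_additiveNoiseKernel hf]
  exact ⟨hkl.1, congrArg (· / _) hkl.2⟩

end Entropy

end AdditiveNoise

section LebesgueEntropy

variable {ι : Type*} [Fintype ι]

lemma pi_withDensity_ofReal {α : ι → Type*} [∀ i, MeasurableSpace (α i)]
    {ν : ∀ i, Measure (α i)} [∀ i, SigmaFinite (ν i)] {p : ∀ i, α i → ℝ}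
    (hnonneg : ∀ i x, 0 ≤ p i x) (hint : ∀ i, Integrable (p i) (ν i)) :
    Measure.pi (fun i => (ν i).withDensity fun x => ENNReal.ofReal (p i x)) =
      (Measure.pi ν).withDensity fun x => ENNReal.ofReal (∏ i, p i (x i)) := by
  have := fun i => isFiniteMeasure_withDensity_ofReal (hint i).hasFiniteIntegral
  refine Measure.pi_eq fun s hs => ?_
  rw [withDensity_apply _ (MeasurableSet.univ_pi hs), Measure.restrict_pi_pi,
    ← ofReal_integral_eq_lintegral_ofReal (Integrable.fintype_prod_dep fun i => (hint i).restrict)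
      (ae_of_all _ fun x => Finset.prod_nonneg fun i _ => hnonneg i (x i)),
    integral_fintype_prod_eq_prod,
    ENNReal.ofReal_prod_of_nonneg fun i _ => integral_nonneg (hnonneg i)]
  refine Finset.prod_congr rfl fun i _ => ?_
  rw [withDensity_apply _ (hs i), ofReal_integral_eq_lintegral_ofReal (hint i).restrict
    (ae_of_all _ (hnonneg i))]

lemma HasDiffEntropy.pi {α : ι → Type*} [∀ i, MeasurableSpace (α i)] {P ν : ∀ i, Measure (α i)}
    [∀ i, IsProbabilityMeasure (P i)] [∀ i, SigmaFinite (ν i)] {h : ι → ℝ}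
    (hP : ∀ i, HasDiffEntropy (P i) (ν i) (h i)) :
    HasDiffEntropy (Measure.pi P) (Measure.pi ν) (∑ i, h i) := by
  choose ℓ hℓ hPℓ hint hℓh using hP
  have hexp : ∀ i, Integrable (fun x => Real.exp (ℓ i x)) (ν i) := fun i => by
    refine (lintegral_ofReal_ne_top_iff_integrable (by fun_prop)
      (ae_of_all _ fun x => Real.exp_nonneg _)).1 ?_
    rw [← setLIntegral_univ, ← withDensity_apply _ MeasurableSet.univ, ← hPℓ i]
    exact measure_ne_top _ _
  refine ⟨fun x => ∑ i, ℓ i (x i), by fun_prop, ?_,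
    integrable_finsetSum _ fun i _ => integrable_comp_eval (hint i), ?_⟩
  · simp_rw [Real.exp_sum, ← pi_withDensity_ofReal (fun i x => Real.exp_nonneg (ℓ i x)) hexp,
      ← hPℓ]
  · rw [integral_finsetSum _ fun i _ => integrable_comp_eval (hint i), ← Finset.sum_neg_distrib]
    exact Finset.sum_congr rfl fun i _ =>
      (integral_comp_eval (hℓ i).aestronglyMeasurable).trans (hℓh i)

variable [DecidableEq ι]

lemma HasDiffEntropy.map_mulVec {P : Measure (ι → ℝ)} [IsProbabilityMeasure P] {h : ℝ}
    (hP : HasDiffEntropy P volume h) {A : Matrix ι ι ℝ} (hA : IsUnit A) :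
    HasDiffEntropy (P.map (A *ᵥ ·)) volume (h + Real.log |A.det|) := by
  obtain ⟨ℓ, hℓ, hPℓ, hint, hℓh⟩ := hP
  have hdet : IsUnit A.det := (isUnit_iff_isUnit_det _).1 hA
  have hmeas : ∀ C : Matrix ι ι ℝ, Measurable fun x : ι → ℝ => C *ᵥ x := fun C =>
    (LinearMap.continuous_of_finiteDimensional C.mulVecLin).measurable
  have hinv : ∀ x, A⁻¹ *ᵥ A *ᵥ x = x := fun x => by
    rw [mulVec_mulVec, nonsing_inv_mul _ hdet, one_mulVec]
  have hℓ' : Measurable fun y => ℓ (A⁻¹ *ᵥ y) := hℓ.comp (hmeas _)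
  have hvol : (volume : Measure (ι → ℝ)).map (A *ᵥ ·) = ENNReal.ofReal |A.det|⁻¹ • volume := by
    rw [← abs_inv]
    exact Real.map_matrix_volume_pi_eq_smul_volume_pi hdet.ne_zero
  have hdensity := hℓ'.sub_const (Real.log |A.det|)
  refine ⟨fun y => ℓ (A⁻¹ *ᵥ y) - Real.log |A.det|, hdensity, ?_, ?_, ?_⟩
  · calc P.map (A *ᵥ ·)
        = (volume.withDensity fun x => ENNReal.ofReal (Real.exp (ℓ (A⁻¹ *ᵥ A *ᵥ x)))).map
            (A *ᵥ ·) := by simp_rw [hinv, ← hPℓ]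
      _ = (ENNReal.ofReal |A.det|⁻¹ • volume).withDensity
            fun y => ENNReal.ofReal (Real.exp (ℓ (A⁻¹ *ᵥ y))) := by
        rw [← hvol, ← map_withDensity_comp (hmeas A) _ (by fun_prop)]
      _ = _ := by
        rw [withDensity_smul_measure, ← withDensity_smul _ (by fun_prop)]
        congr 1 with y
        rw [Pi.smul_apply, smul_eq_mul, ← ENNReal.ofReal_mul (by positivity), Real.exp_sub,
          Real.exp_log (abs_pos.2 hdet.ne_zero), inv_mul_eq_div]
  · rw [integrable_map_measure hdensity.aestronglyMeasurable (hmeas A).aemeasurable]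
    simp only [Function.comp_def, hinv]
    exact hint.sub (integrable_const _)
  · rw [integral_map (hmeas A).aemeasurable hdensity.aestronglyMeasurable]
    simp only [hinv]
    rw [integral_sub hint (integrable_const _), hℓh, integral_const, probReal_univ, one_smul]
    ring

end LebesgueEntropy

lemma hasDiffEntropy_gaussianReal {v : ℝ≥0} (hv : v ≠ 0) :
    HasDiffEntropy (gaussianReal 0 v) volume
      ((Real.log v + Real.log (2 * Real.pi * Real.exp 1)) / 2) := by
  have hv' : (0 : ℝ) < v := by positivity
  have hlog : ∀ x, Real.log (gaussianPDFReal 0 v x) =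
      -(1 / 2) * Real.log (2 * Real.pi * v) - x ^ 2 / (2 * v) := fun x => by
    rw [gaussianPDFReal, Real.log_mul (by positivity) (Real.exp_pos _).ne', Real.log_exp,
      Real.log_inv, Real.log_sqrt (by positivity)]
    ring
  have hsq : Integrable (fun x : ℝ => x ^ 2) (gaussianReal 0 v) :=
    (memLp_id_gaussianReal 2).integrable_sq
  have hvar : ∫ x, x ^ 2 ∂gaussianReal 0 v = v := by
    rw [← variance_of_integral_eq_zero (by fun_prop) (by simp), variance_fun_id_gaussianReal]
  refine ⟨fun x => Real.log (gaussianPDFReal 0 v x), by fun_prop, ?_, ?_, ?_⟩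
  · simp_rw [Real.exp_log (gaussianPDFReal_pos 0 v _ hv)]
    exact gaussianReal_of_var_ne_zero 0 hv
  · simp_rw [hlog]
    exact (integrable_const _).sub (hsq.div_const _)
  · simp_rw [hlog]
    rw [integral_sub (integrable_const _) (hsq.div_const _), integral_const, probReal_univ,
      one_smul, integral_div, hvar, Real.log_mul (by positivity) hv'.ne',
      Real.log_mul (by positivity) (Real.exp_pos 1).ne', Real.log_exp]
    field_simp
    ring

section CenteredGaussian

variable {Ω Ω' ι κ τ : Type*} {mΩ : MeasurableSpace Ω} {mΩ' : MeasurableSpace Ω'}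
  {μ : Measure Ω} {X : Ω → ι → ℝ} {K : Matrix ι ι ℝ}

/-- The random vector `X` has the law `N(0, K)`. -/
structure IsCenteredGaussian (X : Ω → ι → ℝ) (K : Matrix ι ι ℝ) (μ : Measure Ω) : Prop where
  hasGaussianLaw : HasGaussianLaw X μ
  integral_eq_zero : ∀ i, ∫ ω, X ω i ∂μ = 0
  covariance_eq : ∀ i j, cov[fun ω => X ω i, fun ω => X ω j; μ] = K i j

namespace IsCenteredGaussian

lemma comp_measurePreserving (hX : IsCenteredGaussian X K μ) {μ' : Measure Ω'} {f : Ω' → Ω}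
    (hf : MeasurePreserving f μ' μ) : IsCenteredGaussian (X ∘ f) K μ' := by
  have hmeas := hX.hasGaussianLaw.aemeasurable
  have heval := fun i => (hX.hasGaussianLaw.eval i).aemeasurable.aestronglyMeasurable
  refine ⟨⟨?_⟩, fun i => ?_, fun i j => ?_⟩
  · rw [← hf.map_eq] at hmeas
    rw [← AEMeasurable.map_map_of_aemeasurable hmeas hf.aemeasurable, hf.map_eq]
    exact hX.hasGaussianLaw.isGaussian_map
  · rw [← hX.integral_eq_zero i, ← hf.map_eq, integral_map hf.aemeasurable]
    · rfl
    · rw [hf.map_eq]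
      exact heval i
  · rw [← hX.covariance_eq, ← hf.map_eq, covariance_map_fun _ _ hf.aemeasurable]
    · rfl
    all_goals rw [hf.map_eq]; exact heval _

lemma isProbabilityMeasure (hX : IsCenteredGaussian X K μ) : IsProbabilityMeasure μ :=
  hX.hasGaussianLaw.isProbabilityMeasure

lemma map_eval (hX : IsCenteredGaussian X K μ) (i : ι) :
    μ.map (fun ω => X ω i) = gaussianReal 0 (K i i).toNNReal := by
  have hlaw := hX.hasGaussianLaw.eval i
  rw [hlaw.map_eq_gaussianReal, hX.integral_eq_zero, ← covariance_self hlaw.aemeasurable,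
    hX.covariance_eq]

lemma hasDiffEntropy_eval (hX : IsCenteredGaussian X K μ) {i : ι} (hi : 0 < K i i) :
    HasDiffEntropy (μ.map fun ω => X ω i) volume
      ((Real.log (K i i) + Real.log (2 * Real.pi * Real.exp 1)) / 2) := by
  rw [hX.map_eval]
  simpa only [Real.coe_toNNReal _ hi.le] using
    hasDiffEntropy_gaussianReal (Real.toNNReal_pos.2 hi).ne'

lemma memLp_const_mul (hX : IsCenteredGaussian X K μ) (c : ℝ) (i : ι) :
    MemLp (fun ω => c * X ω i) 2 μ :=
  (hX.hasGaussianLaw.eval i).memLp_two.const_mul c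

lemma sumElim [Finite ι] [Finite κ] {Y : Ω → κ → ℝ} {L : Matrix κ κ ℝ}
    (hX : IsCenteredGaussian X K μ) (hY : IsCenteredGaussian Y L μ) (hXY : IndepFun X Y μ) :
    IsCenteredGaussian (fun ω => Sum.elim (X ω) (Y ω)) (fromBlocks K 0 0 L) μ := by
  have := Fintype.ofFinite ι
  have := Fintype.ofFinite κ
  have := hX.isProbabilityMeasure
  have hcov : ∀ i k, cov[fun ω => X ω i, fun ω => Y ω k; μ] = 0 := fun i k =>
    (hXY.comp (measurable_pi_apply i) (measurable_pi_apply k)).covariance_eq_zero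
      (hX.hasGaussianLaw.eval i).memLp_two (hY.hasGaussianLaw.eval k).memLp_two
  refine ⟨?_, ?_, ?_⟩
  · exact (hXY.hasGaussianLaw hX.hasGaussianLaw hY.hasGaussianLaw).map_fun
      (LinearEquiv.sumArrowLequivProdArrow ι κ ℝ ℝ).symm.toLinearMap.toContinuousLinearMap
  · rintro (i | k)
    exacts [hX.integral_eq_zero i, hY.integral_eq_zero k]
  · rintro (i | k) (j | l)
    exacts [hX.covariance_eq i j, hcov i l, (covariance_comm _ _).trans (hcov j k),
      hY.covariance_eq k l]

lemma prod_sumElim [Finite ι] [Finite κ] {ν : Measure Ω'} {Y : Ω' → κ → ℝ}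
    {L : Matrix κ κ ℝ} (hX : IsCenteredGaussian X K μ) (hY : IsCenteredGaussian Y L ν) :
    IsCenteredGaussian (fun ω => Sum.elim (X ω.1) (Y ω.2)) (fromBlocks K 0 0 L) (μ.prod ν) := by
  have := hX.isProbabilityMeasure
  have := hY.isProbabilityMeasure
  exact (hX.comp_measurePreserving measurePreserving_fst).sumElim
    (hY.comp_measurePreserving measurePreserving_snd)
    (indepFun_prod₀ hX.hasGaussianLaw.aemeasurable hY.hasGaussianLaw.aemeasurable)

variable [Fintype ι]

lemma covariance_mulVec (hX : IsCenteredGaussian X K μ) (A : Matrix κ ι ℝ) (B : Matrix τ ι ℝ)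
    (k : κ) (t : τ) :
    cov[fun ω => (A *ᵥ X ω) k, fun ω => (B *ᵥ X ω) t; μ] = (A * K * Bᵀ) k t := by
  have := hX.isProbabilityMeasure
  simp only [mulVec, dotProduct]
  rw [covariance_fun_sum_fun_sum (fun i => hX.memLp_const_mul _ i) fun i => hX.memLp_const_mul _ i]
  simp only [covariance_const_mul_left, covariance_const_mul_right, hX.covariance_eq, mul_apply,
    transpose_apply, Finset.sum_mul]
  rw [Finset.sum_comm]
  exact Finset.sum_congr rfl fun i _ => Finset.sum_congr rfl fun j _ => by ring

lemma mulVec [Finite κ] (hX : IsCenteredGaussian X K μ) (A : Matrix κ ι ℝ) :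
    IsCenteredGaussian (fun ω => A *ᵥ X ω) (A * K * Aᵀ) μ where
  hasGaussianLaw := by
    have := Fintype.ofFinite κ
    exact hX.hasGaussianLaw.map_fun A.mulVecLin.toContinuousLinearMap
  integral_eq_zero k := by
    simp only [Matrix.mulVec, dotProduct]
    have := hX.isProbabilityMeasure
    rw [integral_finsetSum _ fun i _ => (hX.memLp_const_mul _ i).integrable one_le_two]
    simp [integral_const_mul, hX.integral_eq_zero]
  covariance_eq := hX.covariance_mulVec A A

lemma indepFun_mulVec [Finite κ] [Finite τ] (hX : IsCenteredGaussian X K μ) {A : Matrix κ ι ℝ}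
    {B : Matrix τ ι ℝ} (h : A * K * Bᵀ = 0) :
    IndepFun (fun ω => A *ᵥ X ω) (fun ω => B *ᵥ X ω) μ := by
  have := Fintype.ofFinite κ
  have := Fintype.ofFinite τ
  refine HasGaussianLaw.indepFun_of_covariance_eval (X := fun k ω => (A *ᵥ X ω) k)
    (Y := fun t ω => (B *ᵥ X ω) t) (hX.hasGaussianLaw.map_fun
      (A.mulVecLin.prod B.mulVecLin).toContinuousLinearMap) fun k t => ?_
  rw [hX.covariance_mulVec, h, Matrix.zero_apply]

variable [DecidableEq ι]

lemma hasDiffEntropy_of_one (hX : IsCenteredGaussian X 1 μ) :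
    HasDiffEntropy (μ.map X) volume
      (Fintype.card ι * (Real.log (2 * Real.pi * Real.exp 1) / 2)) := by
  have hind : iIndepFun (fun i ω => X ω i) μ :=
    HasGaussianLaw.iIndepFun_of_covariance_eq_zero hX.hasGaussianLaw fun i j hij => by
      rw [hX.covariance_eq, one_apply_ne hij]
  have := hX.isProbabilityMeasure
  have hlaw : μ.map X = Measure.pi fun _ => gaussianReal 0 1 := by
    rw [(iIndepFun_iff_map_fun_eq_pi_map fun i => (hX.hasGaussianLaw.eval i).aemeasurable).1 hind]
    simp_rw [hX.map_eval, one_apply_eq, Real.toNNReal_one]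
  have h := HasDiffEntropy.pi fun _ : ι => hasDiffEntropy_gaussianReal one_ne_zero
  simp only [NNReal.coe_one, Real.log_one, zero_add, Finset.sum_const, Finset.card_univ,
    nsmul_eq_mul] at h
  rw [hlaw]
  exact h

lemma hasDiffEntropy (hX : IsCenteredGaussian X K μ) (hK : K.PosDef) :
    HasDiffEntropy (μ.map X) volume
      ((Real.log K.det + Fintype.card ι * Real.log (2 * Real.pi * Real.exp 1)) / 2) := by
  obtain ⟨G, hG, rfl⟩ := exists_isUnit_eq_mul_transpose hK
  have hdet : IsUnit G.det := (isUnit_iff_isUnit_det _).1 hG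
  have hone : G⁻¹ * (G * Gᵀ) * G⁻¹ᵀ = 1 := by
    rw [nonsing_inv_mul_cancel_left _ _ hdet, ← transpose_mul, nonsing_inv_mul _ hdet,
      transpose_one]
  have hW : IsCenteredGaussian (fun ω => G⁻¹ *ᵥ X ω) 1 μ := hone ▸ hX.mulVec G⁻¹
  have := hX.isProbabilityMeasure
  have := Measure.isProbabilityMeasure_map hW.hasGaussianLaw.aemeasurable
  have hmap : (μ.map fun ω => G⁻¹ *ᵥ X ω).map (G *ᵥ ·) = μ.map X := by
    rw [AEMeasurable.map_map_of_aemeasurable (by fun_prop) hW.hasGaussianLaw.aemeasurable]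
    simp only [Function.comp_def, mulVec_mulVec, mul_nonsing_inv _ hdet, one_mulVec]
  convert hmap ▸ hW.hasDiffEntropy_of_one.map_mulVec hG using 1
  rw [det_mul, det_transpose, Real.log_mul hdet.ne_zero hdet.ne_zero, Real.log_abs]
  ring

end IsCenteredGaussian

lemma isCenteredGaussian_ofLp [Fintype ι] [DecidableEq ι] (hK : K.PosSemidef) :
    IsCenteredGaussian (fun x : EuclideanSpace ℝ ι => x.ofLp) K (multivariateGaussian 0 K) where
  hasGaussianLaw := IsGaussian.hasGaussianLaw_id.map_equiv (EuclideanSpace.equiv ι ℝ)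
  integral_eq_zero i := by
    have h := (EuclideanSpace.proj (𝕜 := ℝ) i).integral_comp_comm
      (IsGaussian.integrable_fun_id (μ := multivariateGaussian 0 K))
    rwa [integral_id_multivariateGaussian, map_zero] at h
  covariance_eq := covariance_eval_multivariateGaussian hK

end CenteredGaussian

section Channel

variable {n : ℕ} {κ τ : Type*} {B Ks Kw Kv : Matrix (Fin n) (Fin n) ℝ}
  {A₁ A₂ A₃ : Matrix κ (Fin n) ℝ} {C₁ C₂ C₃ : Matrix τ (Fin n) ℝ}

/-- The random vector `A₁ s + A₂ w + A₃ v`; every signal of the channel has this form. The rows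
of the `Aᵢ` range over any index type, so that subvectors and pairs of signals are covered too. -/
def linComb (A₁ A₂ A₃ : Matrix κ (Fin n) ℝ) (ω : Sample n) : κ → ℝ :=
  A₁ *ᵥ message ω + A₂ *ᵥ forwardNoise ω + A₃ *ᵥ feedbackNoise ω

lemma linComb_eq_mulVec (A₁ A₂ A₃ : Matrix κ (Fin n) ℝ) (ω : Sample n) :
    linComb A₁ A₂ A₃ ω = fromCols A₁ (fromCols A₂ A₃) *ᵥ
      Sum.elim (message ω) (Sum.elim (forwardNoise ω) (feedbackNoise ω)) := by
  simp only [linComb, fromCols_mulVec_sumElim, add_assoc]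

lemma mulVec_linComb [Fintype κ] (M : Matrix τ κ ℝ) (A₁ A₂ A₃ : Matrix κ (Fin n) ℝ)
    (ω : Sample n) : M *ᵥ linComb A₁ A₂ A₃ ω = linComb (M * A₁) (M * A₂) (M * A₃) ω := by
  simp only [linComb, mulVec_add, mulVec_mulVec]

lemma message_eq_linComb : message = linComb (n := n) 1 0 0 := by
  ext1 ω
  simp [linComb]

lemma feedbackNoise_eq_linComb : feedbackNoise = linComb (n := n) 0 0 1 := by
  ext1 ω
  simp [linComb]

lemma input_eq_linComb (B : Matrix (Fin n) (Fin n) ℝ) : input B = linComb 1 B B := by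
  ext1 ω
  simp only [input, linComb, one_mulVec, mulVec_add, add_assoc]

lemma output_eq_linComb (B : Matrix (Fin n) (Fin n) ℝ) : output B = linComb 1 (1 + B) B := by
  ext1 ω
  simp only [output, input_eq_linComb, linComb, one_mulVec, add_mulVec]
  abel

lemma measurable_linComb (A₁ A₂ A₃ : Matrix κ (Fin n) ℝ) : Measurable (linComb A₁ A₂ A₃) := by
  refine measurable_pi_lambda _ fun k => ?_
  simp only [linComb, message, forwardNoise, feedbackNoise, Pi.add_apply, mulVec, dotProduct]
  fun_prop

lemma measurable_message : Measurable (message (n := n)) :=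
  message_eq_linComb ▸ measurable_linComb 1 0 0

lemma measurable_feedbackNoise : Measurable (feedbackNoise (n := n)) :=
  feedbackNoise_eq_linComb ▸ measurable_linComb 0 0 1

lemma measurable_input (B : Matrix (Fin n) (Fin n) ℝ) : Measurable (input B) :=
  input_eq_linComb B ▸ measurable_linComb 1 B B

lemma measurable_output (B : Matrix (Fin n) (Fin n) ℝ) : Measurable (output B) :=
  output_eq_linComb B ▸ measurable_linComb 1 (1 + B) B

lemma isCenteredGaussian_sources (hKs : Ks.PosSemidef) (hKw : Kw.PosSemidef)
    (hKv : Kv.PosSemidef) :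
    IsCenteredGaussian (fun ω : Sample n =>
        Sum.elim (message ω) (Sum.elim (forwardNoise ω) (feedbackNoise ω)))
      (fromBlocks Ks 0 0 (fromBlocks Kw 0 0 Kv)) (law Ks Kw Kv) :=
  (isCenteredGaussian_ofLp hKs).prod_sumElim
    ((isCenteredGaussian_ofLp hKw).prod_sumElim (isCenteredGaussian_ofLp hKv))

lemma fromCols_mul_fromBlocks_mul_transpose (Ks Kw Kv : Matrix (Fin n) (Fin n) ℝ)
    (A₁ A₂ A₃ : Matrix κ (Fin n) ℝ) (C₁ C₂ C₃ : Matrix τ (Fin n) ℝ) :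
    fromCols A₁ (fromCols A₂ A₃) * fromBlocks Ks 0 0 (fromBlocks Kw 0 0 Kv) *
        (fromCols C₁ (fromCols C₂ C₃))ᵀ =
      A₁ * Ks * C₁ᵀ + A₂ * Kw * C₂ᵀ + A₃ * Kv * C₃ᵀ := by
  simp [fromCols_mul_fromBlocks, transpose_fromCols, fromCols_mul_fromRows, add_assoc]

lemma isCenteredGaussian_linComb [Finite κ] (hKs : Ks.PosSemidef) (hKw : Kw.PosSemidef)
    (hKv : Kv.PosSemidef) (A₁ A₂ A₃ : Matrix κ (Fin n) ℝ) :
    IsCenteredGaussian (linComb A₁ A₂ A₃)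
      (A₁ * Ks * A₁ᵀ + A₂ * Kw * A₂ᵀ + A₃ * Kv * A₃ᵀ) (law Ks Kw Kv) := by
  have h := (isCenteredGaussian_sources hKs hKw hKv).mulVec (fromCols A₁ (fromCols A₂ A₃))
  simp only [← linComb_eq_mulVec, fromCols_mul_fromBlocks_mul_transpose] at h
  exact h

lemma indepFun_linComb [Finite κ] [Finite τ] (hKs : Ks.PosSemidef) (hKw : Kw.PosSemidef)
    (hKv : Kv.PosSemidef) (h : A₁ * Ks * C₁ᵀ + A₂ * Kw * C₂ᵀ + A₃ * Kv * C₃ᵀ = 0) :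
    IndepFun (linComb A₁ A₂ A₃) (linComb C₁ C₂ C₃) (law Ks Kw Kv) := by
  rw [← fromCols_mul_fromBlocks_mul_transpose] at h
  simpa only [← linComb_eq_mulVec] using
    (isCenteredGaussian_sources hKs hKw hKv).indepFun_mulVec h

lemma indepFun_linComb_apply [Finite τ] (hKs : Ks.PosSemidef) (hKw : Kw.PosSemidef)
    (hKv : Kv.PosSemidef) (A₁ A₂ A₃ : Matrix κ (Fin n) ℝ) (k : κ)
    (h : ∀ t, (A₁ * Ks * C₁ᵀ + A₂ * Kw * C₂ᵀ + A₃ * Kv * C₃ᵀ) k t = 0) :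
    IndepFun (linComb C₁ C₂ C₃) (fun ω => linComb A₁ A₂ A₃ ω k) (law Ks Kw Kv) := by
  let row (A : Matrix κ (Fin n) ℝ) : Matrix Unit (Fin n) ℝ := A.submatrix (fun _ => k) id
  have hrow : row A₁ * Ks * C₁ᵀ + row A₂ * Kw * C₂ᵀ + row A₃ * Kv * C₃ᵀ = 0 := by
    ext _ t
    exact h t
  exact (indepFun_linComb hKs hKw hKv hrow).symm.comp measurable_id (measurable_pi_apply ())

lemma inputCov_eq (hKs : Ks.PosSemidef) (hKw : Kw.PosSemidef) (hKv : Kv.PosSemidef)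
    (B : Matrix (Fin n) (Fin n) ℝ) : inputCov B Ks Kw Kv = Ks + B * (Kw + Kv) * Bᵀ := by
  ext i j
  rw [inputCov, of_apply, input_eq_linComb,
    (isCenteredGaussian_linComb hKs hKw hKv 1 B B).covariance_eq]
  simp [Matrix.mul_add, Matrix.add_mul, add_assoc]

/-- The covariance matrix of the total noise `y - s = (1 + B) w + B v` at the receiver. -/
def noiseCov (B Kw Kv : Matrix (Fin n) (Fin n) ℝ) : Matrix (Fin n) (Fin n) ℝ :=
  (1 + B) * Kw * (1 + B)ᵀ + B * Kv * Bᵀ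

/-- The covariance matrix of `y - B v = s + (1 + B) w`, that is, the conditional covariance of the
output given the feedback noise. -/
def condOutputCov (B Ks Kw : Matrix (Fin n) (Fin n) ℝ) : Matrix (Fin n) (Fin n) ℝ :=
  Ks + (1 + B) * Kw * (1 + B)ᵀ

lemma posDef_one_add_mul_mul_transpose (hKw : Kw.PosDef) (hB : IsStrictlyLower B) :
    ((1 + B) * Kw * (1 + B)ᵀ).PosDef := by
  simpa using hKw.mul_mul_conjTranspose_same (B := 1 + B)
    (vecMul_injective_of_isUnit (isUnit_one_add_of_isStrictlyLower hB))

lemma posSemidef_mul_mul_transpose (hKv : Kv.PosSemidef) (B : Matrix (Fin n) (Fin n) ℝ) :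
    (B * Kv * Bᵀ).PosSemidef := by
  simpa using hKv.mul_mul_conjTranspose_same B

lemma posDef_noiseCov (hKw : Kw.PosDef) (hKv : Kv.PosSemidef) (hB : IsStrictlyLower B) :
    (noiseCov B Kw Kv).PosDef :=
  (posDef_one_add_mul_mul_transpose hKw hB).add_posSemidef (posSemidef_mul_mul_transpose hKv B)

lemma posDef_condOutputCov (hKs : Ks.PosSemidef) (hKw : Kw.PosDef) (hB : IsStrictlyLower B) :
    (condOutputCov B Ks Kw).PosDef :=
  (posDef_one_add_mul_mul_transpose hKw hB).posSemidef_add hKs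

end Channel

section Rates

variable {n : ℕ} {B Ks Kw Kv M N : Matrix (Fin n) (Fin n) ℝ} {d e : Fin n → ℝ}

lemma ofReal_div_ofReal_log_two_div (hn : 0 < n) (x : ℝ) :
    ENNReal.ofReal x / ENNReal.ofReal (Real.log 2) / n =
      ENNReal.ofReal (x / Real.log 2 / n) := by
  rw [ENNReal.ofReal_div_of_pos (by positivity), ENNReal.ofReal_div_of_pos (by positivity),
    ENNReal.ofReal_natCast]

lemma rate_eq (hn : 0 < n) (hKs : Ks.PosSemidef) (hKw : Kw.PosDef) (hKv : Kv.PosSemidef)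
    (hB : IsStrictlyLower B) :
    rate B Ks Kw Kv = ENNReal.ofReal (1 / (2 * n) *
      Real.logb 2 ((Ks + noiseCov B Kw Kv).det / (noiseCov B Kw Kv).det)) := by
  have hN := posDef_noiseCov hKw hKv hB
  have hY := hN.posSemidef_add hKs
  have hnoise : (fun ω => output B ω - id (message ω)) = linComb 0 (1 + B) B := by
    ext1 ω
    simp only [output_eq_linComb, linComb, one_mulVec, zero_mulVec, id]
    abel
  have houtput_gauss : IsCenteredGaussian (output B) (Ks + noiseCov B Kw Kv) (law Ks Kw Kv) := by
    simpa [output_eq_linComb, noiseCov, add_assoc, -transpose_add] using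
      isCenteredGaussian_linComb hKs hKw.posSemidef hKv 1 (1 + B) B
  have hnoise_gauss : IsCenteredGaussian (fun ω => output B ω - id (message ω))
      (noiseCov B Kw Kv) (law Ks Kw Kv) := by
    rw [hnoise]
    simpa [noiseCov, -transpose_add] using
      isCenteredGaussian_linComb hKs hKw.posSemidef hKv 0 (1 + B) B
  have hindep : IndepFun message (fun ω => output B ω - id (message ω)) (law Ks Kw Kv) := by
    rw [hnoise, message_eq_linComb]
    exact indepFun_linComb hKs hKw.posSemidef hKv (by simp)
  rw [rate, mutualInfo_eq_ofReal measurable_message (measurable_output B) measurable_id hindep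
    (houtput_gauss.hasDiffEntropy hY) (hnoise_gauss.hasDiffEntropy hN),
    ofReal_div_ofReal_log_two_div hn, Real.logb, Real.log_div hY.det_pos.ne' hN.det_pos.ne']
  congr 1
  field_simp
  ring

lemma mulVec_apply_eq_sum_lt (hM : IsStrictlyLower M) (h : Fin n → ℝ) (i : Fin n) :
    (M *ᵥ h) i = ∑ j : {j : Fin n // j < i}, M i j * h j := by
  rw [← Finset.sum_subtype (Finset.univ.filter fun j => j < i) (by simp) fun j => M i j * h j,
    Finset.sum_filter_of_ne]
  · rfl
  · intro j _ hj
    by_contra hij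
    exact hj (by rw [hM _ _ (not_lt.1 hij), zero_mul])

/-- The data `(y^{i-1}, v)` on which the `i`-th term of the directed information is conditioned. -/
def conditioning (B : Matrix (Fin n) (Fin n) ℝ) (i : Fin n) (ω : Sample n) :
    ({j : Fin n // j < i} → ℝ) × (Fin n → ℝ) :=
  (fun j => output B ω j, feedbackNoise ω)

/-- The linear predictor of `y_i` from `(y^{i-1}, v)`: if `M` triangularizes the covariance matrix
of `y - B v`, then `(M (y - B v))_i` is minus the predictable part of `(y - B v)_i`. -/
def outputPredictor (B M : Matrix (Fin n) (Fin n) ℝ) (i : Fin n)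
    (z : ({j : Fin n // j < i} → ℝ) × (Fin n → ℝ)) : ℝ :=
  (B *ᵥ z.2) i - ∑ j : {j : Fin n // j < i}, M i j * (z.1 j - (B *ᵥ z.2) j)

/-- The linear predictor of `y_i` from `(y^{i-1}, v)` and `x^i`, which reveal the past forward
noise `w = y - x`; here `N` triangularizes the covariance matrix of `w`. -/
def informedPredictor (N : Matrix (Fin n) (Fin n) ℝ) (i : Fin n)
    (z : (({j : Fin n // j < i} → ℝ) × (Fin n → ℝ)) × ({j : Fin n // j ≤ i} → ℝ)) : ℝ :=
  z.2 ⟨i, le_rfl⟩ - ∑ j : {j : Fin n // j < i}, N i j * (z.1.1 j - z.2 ⟨j, j.2.le⟩)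

lemma measurable_conditioning (B : Matrix (Fin n) (Fin n) ℝ) (i : Fin n) :
    Measurable (conditioning B i) := by
  have := measurable_output B
  have := measurable_feedbackNoise (n := n)
  unfold conditioning
  fun_prop

lemma measurable_outputPredictor (B M : Matrix (Fin n) (Fin n) ℝ) (i : Fin n) :
    Measurable (outputPredictor B M i) := by
  unfold outputPredictor mulVec dotProduct
  fun_prop

lemma measurable_informedPredictor (N : Matrix (Fin n) (Fin n) ℝ) (i : Fin n) :
    Measurable (informedPredictor N i) := by
  unfold informedPredictor
  fun_prop

lemma output_sub_outputPredictor (hM : IsStrictlyLower M) (i : Fin n) (ω : Sample n) :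
    output B ω i - outputPredictor B M i (conditioning B i ω) =
      linComb (1 + M) ((1 + M) * (1 + B)) 0 ω i := by
  have hresidual : output B ω - B *ᵥ feedbackNoise ω = linComb 1 (1 + B) 0 ω := by
    simp [output_eq_linComb, linComb]
  have hpredictable := mulVec_apply_eq_sum_lt hM (output B ω - B *ᵥ feedbackNoise ω) i
  simp only [Pi.sub_apply] at hpredictable
  calc output B ω i - outputPredictor B M i (conditioning B i ω)
      = ((1 + M) *ᵥ (output B ω - B *ᵥ feedbackNoise ω)) i := by
        rw [outputPredictor, conditioning, ← hpredictable, add_mulVec, one_mulVec, Pi.add_apply,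
          Pi.sub_apply]
        ring
    _ = linComb (1 + M) ((1 + M) * (1 + B)) 0 ω i := by
        rw [hresidual, mulVec_linComb, mul_one, mul_zero]

lemma output_sub_informedPredictor (hN : IsStrictlyLower N) (i : Fin n) (ω : Sample n) :
    output B ω i - informedPredictor N i (conditioning B i ω, fun j => input B ω j) =
      linComb 0 (1 + N) 0 ω i := by
  have hnoise : forwardNoise ω = output B ω - input B ω := by simp [output]
  have hpredictable := mulVec_apply_eq_sum_lt hN (output B ω - input B ω) i
  simp only [Pi.sub_apply] at hpredictable
  simp only [informedPredictor, conditioning, linComb, zero_mulVec, zero_add, hnoise,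
    ← hpredictable, add_mulVec, one_mulVec, Pi.add_apply, Pi.sub_apply, Pi.zero_apply]
  ring

lemma indepFun_conditioning (hKs : Ks.PosSemidef) (hKw : Kw.PosSemidef) (hKv : Kv.PosSemidef)
    (hM : IsStrictlyLower M) (h : (1 + M) * condOutputCov B Ks Kw * (1 + M)ᵀ = diagonal d)
    (i : Fin n) :
    IndepFun (conditioning B i) (fun ω => linComb (1 + M) ((1 + M) * (1 + B)) 0 ω i)
      (law Ks Kw Kv) := by
  let past (A : Matrix (Fin n) (Fin n) ℝ) : Matrix {j // j < i} (Fin n) ℝ :=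
    A.submatrix Subtype.val id
  let signals : Sample n → {j // j < i} ⊕ Fin n → ℝ :=
    linComb (fromRows (past 1) 0) (fromRows (past (1 + B)) 0) (fromRows (past B) 1)
  have hsignals : IndepFun signals (fun ω => linComb (1 + M) ((1 + M) * (1 + B)) 0 ω i)
      (law Ks Kw Kv) := by
    refine indepFun_linComb_apply hKs hKw hKv _ _ _ i ?_
    rintro (⟨j, hj⟩ | j)
    · calc ((1 + M) * Ks * 1ᵀ + (1 + M) * (1 + B) * Kw * (1 + B)ᵀ + 0 * Kv * Bᵀ :
            Matrix (Fin n) (Fin n) ℝ) i j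
          = ((1 + M) * condOutputCov B Ks Kw) i j := by
            simp only [condOutputCov, transpose_one, Matrix.mul_add (1 + M) Ks, Matrix.mul_assoc,
              mul_one, Matrix.zero_mul, add_zero]
        _ = 0 := mul_apply_eq_zero_of_mul_mul_transpose_eq_diagonal hM h hj
    · change ((1 + M) * Ks * 0ᵀ + (1 + M) * (1 + B) * Kw * 0ᵀ + 0 * Kv * 1ᵀ :
        Matrix (Fin n) (Fin n) ℝ) i j = 0
      simp
  have hconditioning : conditioning B i =
      fun ω => (fun j => signals ω (Sum.inl j), fun j => signals ω (Sum.inr j)) := by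
    simp only [funext_iff, conditioning, output_eq_linComb, feedbackNoise_eq_linComb]
    exact fun _ => rfl
  have hselect : Measurable fun x : {j // j < i} ⊕ Fin n → ℝ =>
      (fun j => x (Sum.inl j), fun j => x (Sum.inr j)) := by fun_prop
  exact hconditioning ▸ hsignals.comp hselect measurable_id

lemma one_add_mul_mul_transpose_apply_eq_zero (hB : IsStrictlyLower B) (hN : IsStrictlyLower N)
    (h : (1 + N) * Kw * (1 + N)ᵀ = diagonal e) {i k : Fin n} (hk : k ≤ i) :
    ((1 + N) * Kw * Bᵀ) i k = 0 := by
  rw [Matrix.mul_apply]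
  refine Finset.sum_eq_zero fun j _ => ?_
  rcases lt_or_ge j i with hj | hj
  · rw [mul_apply_eq_zero_of_mul_mul_transpose_eq_diagonal hN h hj, zero_mul]
  · rw [transpose_apply, hB _ _ (hk.trans hj), mul_zero]

lemma indepFun_conditioning_input (hKs : Ks.PosSemidef) (hKw : Kw.PosSemidef)
    (hKv : Kv.PosSemidef) (hB : IsStrictlyLower B) (hN : IsStrictlyLower N)
    (h : (1 + N) * Kw * (1 + N)ᵀ = diagonal e) (i : Fin n) :
    IndepFun (fun ω => (conditioning B i ω, fun j : {j // j ≤ i} => input B ω j))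
      (fun ω => linComb 0 (1 + N) 0 ω i) (law Ks Kw Kv) := by
  let past (A : Matrix (Fin n) (Fin n) ℝ) : Matrix {j // j < i} (Fin n) ℝ :=
    A.submatrix Subtype.val id
  let present (A : Matrix (Fin n) (Fin n) ℝ) : Matrix {j // j ≤ i} (Fin n) ℝ :=
    A.submatrix Subtype.val id
  have hcov {k : Fin n} (hk : k ≤ i) := one_add_mul_mul_transpose_apply_eq_zero hB hN h hk
  let signals : Sample n → ({j // j < i} ⊕ Fin n) ⊕ {j // j ≤ i} → ℝ :=
    linComb (fromRows (fromRows (past 1) 0) (present 1))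
      (fromRows (fromRows (past (1 + B)) 0) (present B))
      (fromRows (fromRows (past B) 1) (present B))
  have hsignals : IndepFun signals (fun ω => linComb 0 (1 + N) 0 ω i) (law Ks Kw Kv) := by
    refine indepFun_linComb_apply hKs hKw hKv _ _ _ i ?_
    rintro ((⟨j, hj⟩ | j) | ⟨j, hj⟩)
    · change (0 * Ks * 1ᵀ + (1 + N) * Kw * (1 + B)ᵀ + 0 * Kv * Bᵀ :
        Matrix (Fin n) (Fin n) ℝ) i j = 0
      rw [transpose_add, transpose_one, Matrix.mul_add _ 1, mul_one]
      simp [hcov hj.le, mul_apply_eq_zero_of_mul_mul_transpose_eq_diagonal hN h hj]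
    · change (0 * Ks * 0ᵀ + (1 + N) * Kw * 0ᵀ + 0 * Kv * 1ᵀ :
        Matrix (Fin n) (Fin n) ℝ) i j = 0
      simp
    · change (0 * Ks * 1ᵀ + (1 + N) * Kw * Bᵀ + 0 * Kv * Bᵀ :
        Matrix (Fin n) (Fin n) ℝ) i j = 0
      simp [hcov hj]
  have hdata : (fun ω => (conditioning B i ω, fun j : {j // j ≤ i} => input B ω j)) =
      fun ω => ((fun j => signals ω (Sum.inl (Sum.inl j)),
        fun j => signals ω (Sum.inl (Sum.inr j))), fun j => signals ω (Sum.inr j)) := by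
    simp only [funext_iff, conditioning, output_eq_linComb, feedbackNoise_eq_linComb,
      input_eq_linComb]
    exact fun _ => rfl
  have hselect : Measurable fun x : ({j // j < i} ⊕ Fin n) ⊕ {j // j ≤ i} → ℝ =>
      ((fun j => x (Sum.inl (Sum.inl j)), fun j => x (Sum.inl (Sum.inr j))),
        fun j => x (Sum.inr j)) := by fun_prop
  exact hdata ▸ hsignals.comp hselect measurable_id

lemma condMutualInfo_input_output (hKs : Ks.PosSemidef) (hKw : Kw.PosSemidef)
    (hKv : Kv.PosSemidef) (hB : IsStrictlyLower B) (hM : IsStrictlyLower M) (hd : ∀ i, 0 < d i)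
    (hMd : (1 + M) * condOutputCov B Ks Kw * (1 + M)ᵀ = diagonal d) (hN : IsStrictlyLower N)
    (he : ∀ i, 0 < e i) (hNe : (1 + N) * Kw * (1 + N)ᵀ = diagonal e) (i : Fin n) :
    0 ≤ (Real.log (d i) - Real.log (e i)) / 2 ∧
      condMutualInfo (fun ω (j : {j // j ≤ i}) => input B ω j) (fun ω => output B ω i)
        (conditioning B i) (law Ks Kw Kv) =
      ENNReal.ofReal ((Real.log (d i) - Real.log (e i)) / 2) / ENNReal.ofReal (Real.log 2) := by
  have hresidual : IsCenteredGaussian (linComb (1 + M) ((1 + M) * (1 + B)) 0) (diagonal d)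
      (law Ks Kw Kv) := by
    convert isCenteredGaussian_linComb hKs hKw hKv (1 + M) ((1 + M) * (1 + B)) 0 using 1
    simp only [← hMd, condOutputCov, transpose_mul, Matrix.mul_add (1 + M) Ks,
      Matrix.add_mul ((1 + M) * Ks), Matrix.mul_assoc, Matrix.zero_mul, add_zero]
  have hinformed : IsCenteredGaussian (linComb 0 (1 + N) 0) (diagonal e) (law Ks Kw Kv) := by
    convert isCenteredGaussian_linComb hKs hKw hKv 0 (1 + N) 0 using 1
    simp only [← hNe, Matrix.zero_mul, zero_add, add_zero]
  have hresidual_entropy := hresidual.hasDiffEntropy_eval (i := i) (by simpa using hd i)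
  have hinformed_entropy := hinformed.hasDiffEntropy_eval (i := i) (by simpa using he i)
  have hresidual_indep := indepFun_conditioning hKs hKw hKv hM hMd i
  have hinformed_indep := indepFun_conditioning_input hKs hKw hKv hB hN hNe i
  simp only [← output_sub_outputPredictor hM, diagonal_apply_eq]
    at hresidual_entropy hresidual_indep
  simp only [← output_sub_informedPredictor (B := B) hN, diagonal_apply_eq]
    at hinformed_entropy hinformed_indep
  have hinput := measurable_input B
  have houtput := measurable_output B
  have h := condMutualInfo_eq_ofReal (X := fun ω (j : {j // j ≤ i}) => input B ω j)
    (by fun_prop) (by fun_prop : Measurable fun ω => output B ω i) (measurable_conditioning B i)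
    (measurable_outputPredictor B M i) (measurable_informedPredictor N i) hresidual_indep
    hinformed_indep hresidual_entropy hinformed_entropy
  rw [← sub_nonneg, ← sub_div, add_sub_add_right_eq_sub] at h
  exact h

lemma directedRate_eq (hn : 0 < n) (hKs : Ks.PosSemidef) (hKw : Kw.PosDef) (hKv : Kv.PosSemidef)
    (hB : IsStrictlyLower B) :
    directedRate B Ks Kw Kv = ENNReal.ofReal (1 / (2 * n) *
      Real.logb 2 ((condOutputCov B Ks Kw).det / Kw.det)) := by
  have hY := posDef_condOutputCov hKs hKw hB
  obtain ⟨M, d, hM, hd, hMd⟩ := exists_isStrictlyLower_mul_mul_transpose_eq_diagonal hY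
  obtain ⟨N, e, hN, he, hNe⟩ := exists_isStrictlyLower_mul_mul_transpose_eq_diagonal hKw
  have hterm := condMutualInfo_input_output hKs hKw.posSemidef hKv hB hM hd hMd hN he hNe
  have hsum : condDirectedInfo (input B) (output B) feedbackNoise (law Ks Kw Kv) =
      ENNReal.ofReal (∑ i, (Real.log (d i) - Real.log (e i)) / 2) /
        ENNReal.ofReal (Real.log 2) := by
    rw [ENNReal.ofReal_sum_of_nonneg fun i _ => (hterm i).1, div_eq_mul_inv, Finset.sum_mul]
    exact Finset.sum_congr rfl fun i _ => (hterm i).2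
  have hdet : ∑ i, (Real.log (d i) - Real.log (e i)) / 2 =
      Real.log ((condOutputCov B Ks Kw).det / Kw.det) / 2 := by
    rw [Real.log_div hY.det_pos.ne' hKw.det_pos.ne',
      det_eq_prod_of_mul_mul_transpose_eq_diagonal hM hMd,
      det_eq_prod_of_mul_mul_transpose_eq_diagonal hN hNe, Real.log_prod fun i _ => (hd i).ne',
      Real.log_prod fun i _ => (he i).ne', ← Finset.sum_div, Finset.sum_sub_distrib]
  rw [directedRate, hsum, hdet, ofReal_div_ofReal_log_two_div hn, Real.logb]
  congr 1
  field_simp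

end Rates

section Program

variable {n : ℕ} {Kw Kv : Matrix (Fin n) (Fin n) ℝ} {P : ℝ}

lemma posDef_fromBlocks_diagonal {ι κ : Type*} [Finite ι] [Finite κ] {X : Matrix ι ι ℝ}
    {Y : Matrix κ κ ℝ} (hX : X.PosDef) (hY : Y.PosDef) : (fromBlocks X 0 0 Y).PosDef := by
  classical
  have := Fintype.ofFinite ι
  have := Fintype.ofFinite κ
  have := hX.isUnit.invertible
  have hpsd : (fromBlocks X 0 0 Y).PosSemidef := by
    simpa using (PosDef.fromBlocks₁₁ 0 Y hX).2 (by simpa using hY.posSemidef)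
  rw [hpsd.posDef_iff_det_ne_zero, det_fromBlocks_zero₂₁]
  exact (mul_pos hX.det_pos hY.det_pos).ne'

lemma posSemidef_constraintBlock_iff (hKw : Kw.PosDef) (hKv : Kv.PosDef)
    (H B : Matrix (Fin n) (Fin n) ℝ) :
    (constraintBlock Kw Kv H B).PosSemidef ↔ (H - noiseCov B Kw Kv).PosSemidef := by
  have hD := posDef_fromBlocks_diagonal hKw.inv hKv.inv
  have := hD.isUnit.invertible
  have hinv : (fromBlocks Kw⁻¹ 0 0 Kv⁻¹)⁻¹ = fromBlocks Kw 0 0 Kv := by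
    refine inv_eq_right_inv ?_
    simp [fromBlocks_multiply, nonsing_inv_mul _ hKw.det_pos.ne'.isUnit,
      nonsing_inv_mul _ hKv.det_pos.ne'.isUnit]
  have htranspose : (fromCols (1 + B) B)ᴴ = fromRows (1 + Bᵀ) Bᵀ := by
    rw [conjTranspose_eq_transpose_of_trivial, transpose_fromCols, transpose_add, transpose_one]
  have hschur := PosDef.fromBlocks₂₂ H (fromCols (1 + B) B) hD
  rw [hinv, fromCols_mul_fromBlocks, htranspose, fromCols_mul_fromRows] at hschur
  rw [constraintBlock, hschur]
  simp [noiseCov]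

lemma condOutputCov_sub_noiseCov (Kw Kv H B : Matrix (Fin n) (Fin n) ℝ) :
    condOutputCov B (H - noiseCov B Kw Kv) Kw = H - B * Kv * Bᵀ := by
  rw [condOutputCov, noiseCov]
  abel

lemma det_objectiveBlock (hKv : Kv.PosDef) (H B : Matrix (Fin n) (Fin n) ℝ) :
    (objectiveBlock Kv H B).det = Kv⁻¹.det * (H - B * Kv * Bᵀ).det := by
  have := hKv.inv.isUnit.invertible
  rw [objectiveBlock, det_fromBlocks₁₁, invOf_eq_nonsing_inv,
    nonsing_inv_nonsing_inv _ hKv.det_pos.ne'.isUnit]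

lemma posDef_objectiveBlock (hKv : Kv.PosDef) {H B : Matrix (Fin n) (Fin n) ℝ}
    (h : (H - B * Kv * Bᵀ).PosDef) : (objectiveBlock Kv H B).PosDef := by
  have := hKv.inv.isUnit.invertible
  have hpsd : (objectiveBlock Kv H B).PosSemidef := by
    simpa [objectiveBlock] using (PosDef.fromBlocks₁₁ Bᵀ H hKv.inv).2
      (by simpa [nonsing_inv_nonsing_inv _ hKv.det_pos.ne'.isUnit] using h.posSemidef)
  rw [hpsd.posDef_iff_det_ne_zero, det_objectiveBlock hKv]
  exact (mul_pos hKv.inv.det_pos h.det_pos).ne'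

lemma posDef_objectiveBlock_of_mem_feasible (hKw : Kw.PosDef) (hKv : Kv.PosDef)
    {p : Matrix (Fin n) (Fin n) ℝ × Matrix (Fin n) (Fin n) ℝ} (hp : p ∈ feasible Kw Kv P) :
    (objectiveBlock Kv p.1 p.2).PosDef := by
  obtain ⟨-, hblock, hlower⟩ := hp
  refine posDef_objectiveBlock hKv ?_
  rw [← condOutputCov_sub_noiseCov Kw]
  exact posDef_condOutputCov ((posSemidef_constraintBlock_iff hKw hKv _ _).1 hblock) hKw hlower

lemma constraintBlock_convexCombo (Kw Kv H₁ H₂ B₁ B₂ : Matrix (Fin n) (Fin n) ℝ) {a b : ℝ}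
    (hab : a + b = 1) :
    constraintBlock Kw Kv (a • H₁ + b • H₂) (a • B₁ + b • B₂) =
      a • constraintBlock Kw Kv H₁ B₁ + b • constraintBlock Kw Kv H₂ B₂ := by
  obtain rfl := eq_sub_of_add_eq' hab
  ext (i | i | i) (j | j | j) <;> simp [constraintBlock] <;> ring

lemma objectiveBlock_convexCombo (Kv H₁ H₂ B₁ B₂ : Matrix (Fin n) (Fin n) ℝ) {a b : ℝ}
    (hab : a + b = 1) :
    objectiveBlock Kv (a • H₁ + b • H₂) (a • B₁ + b • B₂) =
      a • objectiveBlock Kv H₁ B₁ + b • objectiveBlock Kv H₂ B₂ := by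
  obtain rfl := eq_sub_of_add_eq' hab
  ext (i | i) (j | j) <;> simp [objectiveBlock]
  ring

lemma convex_feasible (Kw Kv : Matrix (Fin n) (Fin n) ℝ) (P : ℝ) :
    Convex ℝ (feasible Kw Kv P) := by
  rintro ⟨H₁, B₁⟩ ⟨htrace₁, hblock₁, hlower₁⟩ ⟨H₂, B₂⟩ ⟨htrace₂, hblock₂, hlower₂⟩ a b ha hb hab
  refine ⟨?_, ?_, fun i j hij => ?_⟩
  · let power (H B : Matrix (Fin n) (Fin n) ℝ) : Matrix (Fin n) (Fin n) ℝ :=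
      H - Kw * Bᵀ - B * Kw - Kw
    have hpower : power (a • H₁ + b • H₂) (a • B₁ + b • B₂) =
        a • power H₁ B₁ + b • power H₂ B₂ := by
      obtain rfl := eq_sub_of_add_eq' hab
      simp only [power, transpose_add, transpose_smul, Matrix.mul_add, Matrix.add_mul,
        Matrix.mul_smul, Matrix.smul_mul]
      module
    calc (power (a • H₁ + b • H₂) (a • B₁ + b • B₂)).trace
        = a • (power H₁ B₁).trace + b • (power H₂ B₂).trace := by
          rw [hpower, trace_add, trace_smul, trace_smul]
      _ ≤ n * P := convex_Iic (n * P) htrace₁ htrace₂ ha hb hab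
  · rw [Prod.fst_add, Prod.snd_add, Prod.smul_mk, Prod.smul_mk,
      constraintBlock_convexCombo _ _ _ _ _ _ hab]
    exact convex_setOf_posSemidef hblock₁ hblock₂ ha hb hab
  · have h₁ : B₁ i j = 0 := hlower₁ i j hij
    have h₂ : B₂ i j = 0 := hlower₂ i j hij
    simp [h₁, h₂]

lemma concaveOn_objective (hKw : Kw.PosDef) (hKv : Kv.PosDef) :
    ConcaveOn ℝ (feasible Kw Kv P) (objective Kw Kv) := by
  refine ⟨convex_feasible Kw Kv P, fun p hp q hq a b ha hb hab => ?_⟩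
  have hlogdet := concaveOn_log_det.2 (posDef_objectiveBlock_of_mem_feasible hKw hKv hp)
    (posDef_objectiveBlock_of_mem_feasible hKw hKv hq) ha hb hab
  rw [← objectiveBlock_convexCombo Kv p.1 q.1 p.2 q.2 hab] at hlogdet
  have hscaled := div_le_div_of_nonneg_right
    (mul_le_mul_of_nonneg_left hlogdet (by positivity : 0 ≤ 1 / (2 * (n : ℝ))))
    (Real.log_pos one_lt_two).le
  obtain rfl := eq_sub_of_add_eq' hab
  simp only [objective, Real.logb, smul_eq_mul, Prod.fst_add, Prod.snd_add, Prod.smul_fst,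
    Prod.smul_snd] at hscaled ⊢
  linear_combination hscaled

end Program

section Schemes

variable {n : ℕ} {Kw Kv : Matrix (Fin n) (Fin n) ℝ} {P : ℝ}

/-- The linear schemes `(B, Ks)` that meet the power constraint. -/
def schemes (Kw Kv : Matrix (Fin n) (Fin n) ℝ) (P : ℝ) :
    Set (Matrix (Fin n) (Fin n) ℝ × Matrix (Fin n) (Fin n) ℝ) :=
  {x | IsStrictlyLower x.1 ∧ x.2.PosSemidef ∧ (x.2 + x.1 * (Kw + Kv) * x.1ᵀ).trace ≤ n * P}

/-- `(1/n) I(S^n; Y^n)` as a real-valued function of the scheme `(B, Ks)`. -/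
def rateReal (Kw Kv : Matrix (Fin n) (Fin n) ℝ)
    (x : Matrix (Fin n) (Fin n) ℝ × Matrix (Fin n) (Fin n) ℝ) : ℝ :=
  1 / (2 * n) * Real.logb 2 ((x.2 + noiseCov x.1 Kw Kv).det / (noiseCov x.1 Kw Kv).det)

/-- `(1/n) I(X^n → Y^n | V^n)` as a real-valued function of the scheme `(B, Ks)`. -/
def directedRateReal (Kw : Matrix (Fin n) (Fin n) ℝ)
    (x : Matrix (Fin n) (Fin n) ℝ × Matrix (Fin n) (Fin n) ℝ) : ℝ :=
  1 / (2 * n) * Real.logb 2 ((condOutputCov x.1 x.2 Kw).det / Kw.det)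

lemma zero_mem_schemes (Kw Kv : Matrix (Fin n) (Fin n) ℝ) (hP : 0 ≤ P) :
    (0, 0) ∈ schemes Kw Kv P :=
  ⟨fun _ _ _ => rfl, PosSemidef.zero, by simpa using mul_nonneg n.cast_nonneg hP⟩

lemma rateReal_zero (hKw : Kw.PosDef) : rateReal Kw Kv (0, 0) = 0 := by
  simp [rateReal, noiseCov, hKw.det_pos.ne']

lemma directedRateReal_zero (hKw : Kw.PosDef) : directedRateReal Kw (0, 0) = 0 := by
  simp [directedRateReal, condOutputCov, hKw.det_pos.ne']

lemma achievableRates_eq_image (hn : 0 < n) (hKw : Kw.PosDef) (hKv : Kv.PosSemidef) :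
    achievableRates Kw Kv P = (fun x => ENNReal.ofReal (rateReal Kw Kv x)) '' schemes Kw Kv P := by
  ext r
  constructor
  · rintro ⟨B, Ks, hB, hKs, hpower, rfl⟩
    exact ⟨(B, Ks), ⟨hB, hKs, hpower⟩, (rate_eq hn hKs hKw hKv hB).symm⟩
  · rintro ⟨⟨B, Ks⟩, ⟨hB, hKs, hpower⟩, rfl⟩
    exact ⟨B, Ks, hB, hKs, hpower, (rate_eq hn hKs hKw hKv hB).symm⟩

lemma directedRates_eq_image (hn : 0 < n) (hKw : Kw.PosDef) (hKv : Kv.PosSemidef) :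
    directedRates Kw Kv P =
      (fun x => ENNReal.ofReal (directedRateReal Kw x)) '' schemes Kw Kv P := by
  ext r
  constructor
  · rintro ⟨B, Ks, hB, hKs, hpower, rfl⟩
    rw [inputCov_eq hKs hKw.posSemidef hKv] at hpower
    exact ⟨(B, Ks), ⟨hB, hKs, hpower⟩, (directedRate_eq hn hKs hKw hKv hB).symm⟩
  · rintro ⟨⟨B, Ks⟩, ⟨hB, hKs, hpower⟩, rfl⟩
    refine ⟨B, Ks, hB, hKs, ?_, (directedRate_eq hn hKs hKw hKv hB).symm⟩
    rwa [inputCov_eq hKs hKw.posSemidef hKv]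

lemma mem_feasible_iff (hKw : Kw.PosDef) (hKv : Kv.PosDef) (H B : Matrix (Fin n) (Fin n) ℝ) :
    (H, B) ∈ feasible Kw Kv P ↔ (B, H - noiseCov B Kw Kv) ∈ schemes Kw Kv P := by
  have hpower : H - noiseCov B Kw Kv + B * (Kw + Kv) * Bᵀ = H - Kw * Bᵀ - B * Kw - Kw := by
    rw [noiseCov, transpose_add, transpose_one]
    noncomm_ring
  simp only [feasible, schemes, Set.mem_ofPred_eq, hpower, posSemidef_constraintBlock_iff hKw hKv]
  tauto

lemma objective_eq_directedRateReal (hKw : Kw.PosDef) (hKv : Kv.PosDef)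
    {H B : Matrix (Fin n) (Fin n) ℝ} (h : (B, H - noiseCov B Kw Kv) ∈ schemes Kw Kv P) :
    objective Kw Kv (H, B) = directedRateReal Kw (B, H - noiseCov B Kw Kv) := by
  have hdet := (posDef_condOutputCov h.2.1 hKw h.1).det_pos.ne'
  rw [directedRateReal, Real.logb_div hdet hKw.det_pos.ne']
  simp only [condOutputCov_sub_noiseCov] at hdet ⊢
  rw [objective, det_objectiveBlock hKv, det_mul, Real.logb_mul hKv.inv.det_pos.ne' hdet,
    Real.logb_mul hKv.inv.det_pos.ne' hKw.det_pos.ne']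
  ring

lemma image_objective_feasible (hKw : Kw.PosDef) (hKv : Kv.PosDef) :
    objective Kw Kv '' feasible Kw Kv P = directedRateReal Kw '' schemes Kw Kv P := by
  ext r
  constructor
  · rintro ⟨⟨H, B⟩, hp, rfl⟩
    have hx := (mem_feasible_iff hKw hKv H B).1 hp
    exact ⟨_, hx, (objective_eq_directedRateReal hKw hKv hx).symm⟩
  · rintro ⟨⟨B, Ks⟩, hx, rfl⟩
    rw [← add_sub_cancel_right Ks (noiseCov B Kw Kv)] at hx ⊢
    exact ⟨_, (mem_feasible_iff hKw hKv _ B).2 hx, objective_eq_directedRateReal hKw hKv hx⟩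

lemma rateReal_le_directedRateReal (hKw : Kw.PosDef) (hKv : Kv.PosSemidef)
    {x : Matrix (Fin n) (Fin n) ℝ × Matrix (Fin n) (Fin n) ℝ} (hx : x ∈ schemes Kw Kv P) :
    rateReal Kw Kv x ≤ directedRateReal Kw x := by
  obtain ⟨hB, hKs, -⟩ := hx
  have hnoise := posDef_noiseCov hKw hKv hB
  have hdet : ((1 + x.1) * Kw * (1 + x.1)ᵀ).det = Kw.det := by
    rw [det_mul, det_mul, det_transpose, det_one_add_of_isStrictlyLower hB, one_mul, mul_one]
  have hratio : (x.2 + noiseCov x.1 Kw Kv).det / (noiseCov x.1 Kw Kv).det ≤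
      (condOutputCov x.1 x.2 Kw).det / Kw.det := by
    simpa only [noiseCov, condOutputCov, add_comm x.2, hdet] using
      det_add_div_det_le_of_posSemidef_sub (posDef_one_add_mul_mul_transpose hKw hB)
        (Y := noiseCov x.1 Kw Kv)
        (by simpa [noiseCov] using posSemidef_mul_mul_transpose hKv x.1) hKs
  exact mul_le_mul_of_nonneg_left (Real.logb_le_logb_of_le one_lt_two
    (div_pos (hnoise.posSemidef_add hKs).det_pos hnoise.det_pos) hratio) (by positivity)

end Schemes

section Maxima

lemma sq_apply_le_trace_mul_transpose {ι κ : Type*} [Fintype ι] [Fintype κ] (A : Matrix ι κ ℝ)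
    (i : ι) (j : κ) : A i j ^ 2 ≤ (A * Aᵀ).trace := by
  simp only [trace, diag, Matrix.mul_apply, transpose_apply, ← sq]
  calc A i j ^ 2
      ≤ ∑ l, A i l ^ 2 :=
        Finset.single_le_sum (f := fun l => A i l ^ 2) (fun _ _ => sq_nonneg _) (Finset.mem_univ j)
    _ ≤ ∑ k, ∑ l, A k l ^ 2 :=
        Finset.single_le_sum (f := fun k => ∑ l, A k l ^ 2)
          (fun _ _ => Finset.sum_nonneg fun _ _ => sq_nonneg _) (Finset.mem_univ i)

lemma isCompact_setOf_trace_mul_transpose_le {ι κ : Type*} [Fintype ι] [Fintype κ] (c : ℝ) :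
    IsCompact {A : Matrix ι κ ℝ | (A * Aᵀ).trace ≤ c} := by
  have hbox : IsCompact (Set.univ.pi fun _ => Set.univ.pi fun _ => Set.Icc (-√c) (√c) :
      Set (Matrix ι κ ℝ)) :=
    isCompact_univ_pi fun _ => isCompact_univ_pi fun _ => isCompact_Icc
  refine hbox.of_isClosed_subset
    (isClosed_le (Continuous.matrix_trace (by fun_prop)) continuous_const) fun A hA i _ j _ => ?_
  exact abs_le.1 (Real.abs_le_sqrt ((sq_apply_le_trace_mul_transpose A i j).trans hA))

lemma isClosed_setOf_posSemidef {ι : Type*} [Finite ι] :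
    IsClosed {A : Matrix ι ι ℝ | A.PosSemidef} := by
  have := Fintype.ofFinite ι
  simp only [posSemidef_iff_dotProduct_mulVec, Set.ofPred_and, Set.ofPred_forall]
  exact (isClosed_eq (by fun_prop) (by fun_prop)).inter
    (isClosed_iInter fun x => isClosed_le (by fun_prop) (by fun_prop))

variable {n : ℕ} {Kw Kv : Matrix (Fin n) (Fin n) ℝ} {P : ℝ}

lemma isClosed_setOf_isStrictlyLower :
    IsClosed {B : Matrix (Fin n) (Fin n) ℝ | IsStrictlyLower B} := by
  simp only [IsStrictlyLower, Set.ofPred_forall]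
  exact isClosed_iInter fun i => isClosed_iInter fun j => isClosed_iInter fun _ =>
    isClosed_eq (continuous_id.matrix_elem i j) continuous_const

lemma isClosed_schemes (Kw Kv : Matrix (Fin n) (Fin n) ℝ) (P : ℝ) :
    IsClosed (schemes Kw Kv P) := by
  have hpower : Continuous fun x : Matrix (Fin n) (Fin n) ℝ × Matrix (Fin n) (Fin n) ℝ =>
      (x.2 + x.1 * (Kw + Kv) * x.1ᵀ).trace := Continuous.matrix_trace (by fun_prop)
  exact (isClosed_setOf_isStrictlyLower.preimage continuous_fst).inter
    ((isClosed_setOf_posSemidef.preimage continuous_snd).inter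
      (isClosed_le hpower continuous_const))

-- With `Kw + Kv = G Gᵀ` and `Ks = C Cᵀ` the power is the sum of the squared entries of `B G`
-- and `C`.
lemma isCompact_schemes (h : (Kw + Kv).PosDef) : IsCompact (schemes Kw Kv P) := by
  obtain ⟨G, hG, hGK⟩ := exists_isUnit_eq_mul_transpose h
  have hball := isCompact_setOf_trace_mul_transpose_le (ι := Fin n) (κ := Fin n) (n * P)
  have himage := (hball.prod hball).image (f := fun x => (x.1 * G⁻¹, x.2 * x.2ᵀ)) (by fun_prop)
  refine himage.of_isClosed_subset (isClosed_schemes Kw Kv P) ?_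
  rintro ⟨B, Ks⟩ ⟨-, hKs, hpower⟩
  obtain ⟨C, rfl⟩ := exists_eq_mul_transpose hKs
  have hsplit : (B * G * (B * G)ᵀ).trace + (C * Cᵀ).trace ≤ n * P := by
    rw [hGK, trace_add, add_comm] at hpower
    simpa only [transpose_mul, Matrix.mul_assoc] using hpower
  have htrace_nonneg : ∀ A : Matrix (Fin n) (Fin n) ℝ, 0 ≤ (A * Aᵀ).trace := fun A => by
    simpa using (posSemidef_self_mul_conjTranspose A).trace_nonneg
  refine ⟨(B * G, C), ⟨?_, ?_⟩, ?_⟩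
  · exact (le_add_of_nonneg_right (htrace_nonneg C)).trans hsplit
  · exact (le_add_of_nonneg_left (htrace_nonneg (B * G))).trans hsplit
  · simp only [mul_nonsing_inv_cancel_right _ _ ((isUnit_iff_isUnit_det _).1 hG)]

lemma continuousOn_rateReal (hKw : Kw.PosDef) (hKv : Kv.PosSemidef) :
    ContinuousOn (rateReal Kw Kv) (schemes Kw Kv P) := by
  have hnoise : ∀ x ∈ schemes Kw Kv P, (noiseCov x.1 Kw Kv).PosDef :=
    fun x hx => posDef_noiseCov hKw hKv hx.1
  have hdet : Continuous fun x : Matrix (Fin n) (Fin n) ℝ × Matrix (Fin n) (Fin n) ℝ =>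
      (x.2 + noiseCov x.1 Kw Kv).det := Continuous.matrix_det (by unfold noiseCov; fun_prop)
  have hdet_noise : Continuous fun x : Matrix (Fin n) (Fin n) ℝ × Matrix (Fin n) (Fin n) ℝ =>
      (noiseCov x.1 Kw Kv).det := Continuous.matrix_det (by unfold noiseCov; fun_prop)
  exact (((hdet.continuousOn.div hdet_noise.continuousOn fun x hx => (hnoise x hx).det_pos.ne').log
    fun x hx => (div_pos ((hnoise x hx).posSemidef_add hx.2.1).det_pos
      (hnoise x hx).det_pos).ne').div_const _).const_mul _

lemma continuousOn_directedRateReal (hKw : Kw.PosDef) :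
    ContinuousOn (directedRateReal Kw) (schemes Kw Kv P) := by
  have hdet : Continuous fun x : Matrix (Fin n) (Fin n) ℝ × Matrix (Fin n) (Fin n) ℝ =>
      (condOutputCov x.1 x.2 Kw).det := Continuous.matrix_det (by unfold condOutputCov; fun_prop)
  exact (((hdet.div_const _).continuousOn.log fun x hx => (div_pos
    (posDef_condOutputCov hx.2.1 hKw hx.1).det_pos hKw.det_pos).ne').div_const _).const_mul _

lemma exists_isGreatest_image_ofReal {X : Type*} [TopologicalSpace X] {s : Set X} {f : X → ℝ}
    {x : X} (hs : IsCompact s) (hf : ContinuousOn f s) (hx : x ∈ s) (hfx : 0 ≤ f x) :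
    ∃ R : ℝ≥0, IsGreatest (f '' s) R ∧
      IsGreatest ((fun x => ENNReal.ofReal (f x)) '' s) (R : ℝ≥0∞) := by
  obtain ⟨r, hr⟩ := (hs.image_of_continuousOn hf).exists_isGreatest ⟨f x, x, hx, rfl⟩
  have hr_nonneg : 0 ≤ r := hfx.trans (hr.2 ⟨x, hx, rfl⟩)
  lift r to ℝ≥0 using hr_nonneg
  have hgreatest := ENNReal.ofReal_mono.map_isGreatest hr
  rw [Set.image_image, ENNReal.ofReal_coe_nnreal] at hgreatest
  exact ⟨r, hr, hgreatest⟩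

end Maxima

end NoisyFeedback

open NoisyFeedback in
theorem theorem1 {n : ℕ} (hn : 0 < n) (Kw Kv : Matrix (Fin n) (Fin n) ℝ)
    (hKw : Kw.PosDef) (hKv : Kv.PosDef) (P : ℝ) (hP : 0 ≤ P) :
    -- the program is a convex max-det program, with `log det` taken of positive definite matrices
    Convex ℝ (NoisyFeedback.feasible Kw Kv P) ∧
    (∀ p ∈ NoisyFeedback.feasible Kw Kv P, (NoisyFeedback.objectiveBlock Kv p.1 p.2).PosDef) ∧
    ConcaveOn ℝ (NoisyFeedback.feasible Kw Kv P) (NoisyFeedback.objective Kw Kv) ∧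
    -- the three maxima are attained; the first is at most the second, which equals the third
    ∃ R C : ℝ≥0,
      IsGreatest (NoisyFeedback.achievableRates Kw Kv P) (R : ℝ≥0∞) ∧
      IsGreatest (NoisyFeedback.directedRates Kw Kv P) (C : ℝ≥0∞) ∧
      IsGreatest (NoisyFeedback.objective Kw Kv '' NoisyFeedback.feasible Kw Kv P) (C : ℝ) ∧
      R ≤ C := by
  have hcompact := isCompact_schemes (P := P) (hKw.add hKv)
  have hzero := zero_mem_schemes Kw Kv hP
  obtain ⟨R, hR, hR_rate⟩ := exists_isGreatest_image_ofReal hcompact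
    (continuousOn_rateReal hKw hKv.posSemidef) hzero (rateReal_zero hKw).ge
  obtain ⟨C, hC, hC_rate⟩ := exists_isGreatest_image_ofReal hcompact
    (continuousOn_directedRateReal hKw) hzero (directedRateReal_zero hKw).ge
  refine ⟨convex_feasible Kw Kv P, fun p hp => posDef_objectiveBlock_of_mem_feasible hKw hKv hp,
    concaveOn_objective hKw hKv, R, C, ?_, ?_, ?_, ?_⟩
  · rwa [achievableRates_eq_image hn hKw hKv.posSemidef]
  · rwa [directedRates_eq_image hn hKw hKv.posSemidef]
  · rwa [image_objective_feasible hKw hKv]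
  · obtain ⟨x, hx, hxR⟩ := hR.1
    have hRC : (R : ℝ) ≤ C := hxR ▸
      (rateReal_le_directedRateReal hKw hKv.posSemidef hx).trans (hC.2 ⟨x, hx, rfl⟩)
    exact_mod_cast hRC

end
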